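/- Let $\Omega\subset\mathbb R^2$ be a simply connected open set (bounded or unbounded) with piecewise $C^1$ boundary: outside a locally finite set of corners, $\partial\Omega$ is locally a $C^1$ curve with $\Omega$ on one side, and near each corner it is a finite union of simple regular $C^1$ arcs starting at that corner. Let $\mathcal P$ be the space of real polynomials in two variables. Let $\rho:\Omega\to\mathbb R$ be measurable, positive almost everywhere, with $x_1^m x_2^n\rho\in L^1(\Omega)$ for all integers $m,n\ge 0$, and let $\Phi=(\phi_{ik})$ be a symmetric $2\times 2$ matrix of polynomials of degree at most $2$ that is positive definite at every point of $\Omega$. Assume: (i) (Pearson equation) $\rho$ is differentiable on $\Omega$ and there are $D_1,D_2\in\mathbb R^2$ with $\det(D_1,D_2)\neq0$ and $E_1,E_2\in\mathbb R$ such that, on $\Omega$, $\operatorname{div}(\rho\Phi)=\rho\,(\psi_1,\psi_2)$, where $\psi_i(x)=x^tD_i+E_i$ and $\operatorname{div}(\rho\Phi)$ has $i$-th entry $\sum_k\partial_{x_k}(\rho\phi_{ki})$. (ii) (Neumann-type boundary condition) With $\Omega_j=\Omega\cap B(0,j)$ and $\vec n_j$ the outward unit normal of $\partial\Omega_j$,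 for every $p\in\mathcal P$, $$\lim_{j\to\infty}1_{\partial\Omega_j}(\rho\Phi\nabla p)\cdot\vec n_j=0\quad\text{pointwise.}$$ Here, at a point $x\in\partial\Omega_j$ where the normal $\vec n_j=\vec n_j(x)$ exists, the value of $(\rho\Phi\nabla p)\cdot\vec n_j$ is $\lim_{t\downarrow0}(\rho\Phi\nabla p)(x-t\vec n_j)\cdot\vec n_j$, which is required to exist for all $j$ large enough (depending on $p$ and $x$); nothing is required at points of $\partial\Omega_j$ without a normal. Let $u$ be a $C^1$ function on $\overline\Omega$ (in particular, any smooth function on $\overline\Omega$) such that $u\in L^2(\Omega,\rho)$ and $\nabla u\in L^2(\Omega,\rho\Phi)$, that is, $$\int_\Omega u^2\rho\,dx_1dx_2<\infty\quad\text{and}\quad\int_\Omega(\nabla u)^t\rho\Phi\,\nabla u\,dx_1dx_2<\infty.$$ Then for every $v=(v_1,v_2)^t\in\mathcal P\times\mathcal P$ the functions $u\operatorname{div}(\rho\Phi v)$ and $(\nabla u)^t\rho\Phi v$ are integrable on $\Omega$, and $$\int_\Omega u\operatorname{div}(\rho\Phi v)\,dx_1dx_2=-\int_\Omega(\nabla u)^t\rho\Phi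 v\,dx_1dx_2 .$$ -/

import Mathlib

open MeasureTheory Filter Topology Matrix

noncomputable section

/-- The Euclidean plane `ℝ²`. -/
abbrev Plane : Type := EuclideanSpace ℝ (Fin 2)

/-- The ring `𝒫` of real polynomials in two variables. -/
abbrev Poly2 : Type := MvPolynomial (Fin 2) ℝ

/-- The value of a polynomial at a point of the plane. -/
def polyAt (p : Poly2) (x : Plane) : ℝ := MvPolynomial.eval x.ofLp p

/-- The polynomial vector field with components `v 0`, `v 1`. -/
def polyField (v : Fin 2 → Poly2) (x : Plane) : Plane :=
  WithLp.toLp 2 (fun i => polyAt (v i) x)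

/-- The value of a polynomial matrix at a point of the plane. -/
def polyMatAt (Φ : Matrix (Fin 2) (Fin 2) Poly2) (x : Plane) : Matrix (Fin 2) (Fin 2) ℝ :=
  Matrix.of (fun i k => polyAt (Φ i k) x)

/-- The vector field `ρ Φ w`. -/
def weightedField (ρ : Plane → ℝ) (Φ : Matrix (Fin 2) (Fin 2) Poly2) (w : Plane → Plane)
    (x : Plane) : Plane :=
  WithLp.toLp 2 (ρ x • (polyMatAt Φ x *ᵥ (w x).ofLp))

/-- The divergence `∂₁F₁ + ∂₂F₂` of a vector field. -/
def divergence (F : Plane → Plane) (x : Plane) : ℝ :=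
  ∑ i : Fin 2, fderiv ℝ (fun y => F y i) x (EuclideanSpace.single i 1)

/-- `n` is the outward unit normal of `∂U` at `x`: near `x` the set `U` is the side `g < 0` of the
zero set of a `C¹` function `g` whose gradient at `x` is a positive multiple of `n`. There is at
most one such `n`, and there is none at a corner. -/
def IsOutwardUnitNormal (U : Set Plane) (x n : Plane) : Prop :=
  x ∈ frontier U ∧ ‖n‖ = 1 ∧
    ∃ g : Plane → ℝ, ContDiffAt ℝ 1 g x ∧ g x = 0 ∧ (∃ c : ℝ, 0 < c ∧ gradient g x = c • n) ∧
      ∀ᶠ y in 𝓝 x, (y ∈ U ↔ g y < 0)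

/-- `γ` restricted to `[0, 1]` is a simple regular `C¹` arc (up to and including its endpoints)
that starts at `x`. -/
def IsC1ArcFrom (x : Plane) (γ : ℝ → Plane) : Prop :=
  γ 0 = x ∧ Set.InjOn γ (Set.Icc 0 1) ∧ ContDiffOn ℝ 1 γ (Set.Icc 0 1) ∧
    ∀ t ∈ Set.Icc (0 : ℝ) 1, derivWithin γ (Set.Icc 0 1) t ≠ 0

/-- `∂U` is piecewise `C¹`: apart from a locally finite set `S` of corners it is locally a `C¹`
curve with `U` on one side, and near each corner it consists of finitely many `C¹` arcs that start
at the corner. -/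
def HasPiecewiseC1Boundary (U : Set Plane) : Prop :=
  ∃ S : Set Plane, S ⊆ frontier U ∧
    (∀ R : ℝ, (S ∩ Metric.closedBall 0 R).Finite) ∧
    (∀ x ∈ frontier U \ S, ∃ n, IsOutwardUnitNormal U x n) ∧
    ∀ x ∈ S, ∃ (k : ℕ) (γ : Fin k → ℝ → Plane), (∀ i, IsC1ArcFrom x (γ i)) ∧
      ∀ᶠ y in 𝓝 x, (y ∈ frontier U ↔ ∃ i, y ∈ γ i '' Set.Icc 0 1)

/-- `ρ` is a moment weight function on `Ω`: measurable, positive almost everywhere, and all its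
moments (in particular its integral) are finite. Only the values of `ρ` on `Ω` matter. -/
structure IsMomentWeight (Ω : Set Plane) (ρ : Plane → ℝ) : Prop where
  measurable : Measurable (fun x : Ω => ρ x)
  pos : ∀ᵐ x ∂(volume.restrict Ω), 0 < ρ x
  moments : ∀ m n : ℕ, IntegrableOn (fun x : Plane => x 0 ^ m * x 1 ^ n * ρ x) Ω

/-- The Pearson type equation `div (ρ Φ) = ρ (ψ₁, ψ₂)` on `Ω`, where `ψᵢ(x) = xᵗ Dᵢ + Eᵢ` and the
matrix `D` with columns `D₁, D₂` is invertible. -/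
def PearsonEquation (Ω : Set Plane) (ρ : Plane → ℝ) (Φ : Matrix (Fin 2) (Fin 2) Poly2) : Prop :=
  DifferentiableOn ℝ ρ Ω ∧
    ∃ (D : Matrix (Fin 2) (Fin 2) ℝ) (E : Fin 2 → ℝ), D.det ≠ 0 ∧
      ∀ x ∈ Ω, ∀ i : Fin 2,
        divergence (fun y => WithLp.toLp 2 (fun k => ρ y * polyMatAt Φ y k i)) x =
          ρ x * ((∑ k : Fin 2, x k * D k i) + E i)

/-- The truncation `Ω_j = Ω ∩ B(O, j)`. -/
def truncation (Ω : Set Plane) (j : ℕ) : Set Plane := Ω ∩ Metric.ball 0 (j : ℝ)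

/-- The Neumann type boundary condition: for every polynomial `p`,
`1_{∂Ω_j} (ρ Φ ∇p) · n_j → 0` pointwise as `j → ∞`. As `ρ` lives on `Ω` only, the value `T j x` of
`(ρ Φ ∇p) · n_j` at a point `x` of `∂Ω_j` where the outward unit normal exists is the limit along
the inner normal; at the corners of `∂Ω_j`, where there is no normal, nothing is required. -/
def NeumannCondition (Ω : Set Plane) (ρ : Plane → ℝ) (Φ : Matrix (Fin 2) (Fin 2) Poly2) : Prop :=
  ∀ p : Poly2, ∃ T : ℕ → Plane → ℝ, ∀ x : Plane,
    (∀ᶠ j in atTop, ∀ n : Plane, IsOutwardUnitNormal (truncation Ω j) x n →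
      Tendsto (fun t : ℝ => inner ℝ
          (weightedField ρ Φ (polyField (fun i => MvPolynomial.pderiv i p)) (x - t • n)) n)
        (𝓝[>] 0) (𝓝 (T j x))) ∧
    Tendsto (fun j => (frontier (truncation Ω j)).indicator (T j) x) atTop (𝓝 0)

/-- `u ∈ L²(Ω, ρ)`. -/
def MemL2Weight (Ω : Set Plane) (ρ : Plane → ℝ) (u : Plane → ℝ) : Prop :=
  AEStronglyMeasurable u (volume.restrict Ω) ∧ IntegrableOn (fun x => u x ^ 2 * ρ x) Ω

/-- `h ∈ L²(Ω, ρ Φ)`, that is `∫_Ω hᵗ ρ Φ h < ∞`. -/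
def MemL2Matrix (Ω : Set Plane) (ρ : Plane → ℝ) (Φ : Matrix (Fin 2) (Fin 2) Poly2)
    (h : Plane → Plane) : Prop :=
  AEStronglyMeasurable h (volume.restrict Ω) ∧
    IntegrableOn (fun x => inner ℝ (h x) (weightedField ρ Φ h x)) Ω

end

/-! The difficulty is the boundary term: nothing bounds `u` or `ρ` near `∂Ω`. The hypotheses,
however, make `Φ` degenerate in the normal direction along the whole boundary, in an algebraic way,
and cutoffs built from that degeneracy cost nothing.

At a regular boundary point with normal `n`, taking `p` linear with gradient `n` in the Neumann
condition gives `ρ nᵗΦn → 0` along the inner normal. If `nᵗΦn > 0` there, then `X = -Φn` points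
strictly inward, and the Pearson equation reads `∂_X ρ = -Bρ` with `B` a polynomial. Following the
flow of `X` into a compact part of `Ω` keeps `ρ` away from zero (`exists_pos_le_of_inward_field`), a
contradiction. So `nᵗΦn = 0`, and semidefiniteness gives `Φn = 0` (`mulVec_normal_eq_zero`).

Hence `det Φ` vanishes on `∂Ω`. The polynomials vanishing on `∂Ω` form a principal ideal `(f)`,
because coprime plane polynomials have finitely many common zeros and `∂Ω` has no isolated point.
Since `f` divides `det Φ`, it has no zero in `Ω`. The rows of `Φ` are tangent to `∂Ω`, so `Φ∇f`
vanishes there and `f` divides its entries (`exists_boundary_polynomial`).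

Now cut off by `w_N = θ(N f²)(1 - θ(|x|²/N))`. The field `w_N u ρΦv` has compact support in `Ω`, so
its divergence integrates to zero. As `Φv·∇f² = f² M` with `M` polynomial, the boundary layer
contributes `N f² θ'(N f²) M`, bounded by a polynomial uniformly in `N`. Dominated convergence
removes the cutoff. -/

/-! ### Evaluation and derivatives of plane polynomials -/

theorem polyAt_C (a : ℝ) (x : Plane) : polyAt (MvPolynomial.C a) x = a := by
  simp [polyAt]

theorem polyAt_X (i : Fin 2) (x : Plane) : polyAt (MvPolynomial.X i) x = x i := by
  simp [polyAt]

theorem polyAt_add (p q : Poly2) (x : Plane) : polyAt (p + q) x = polyAt p x + polyAt q x := by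
  simp [polyAt]

theorem polyAt_sub (p q : Poly2) (x : Plane) : polyAt (p - q) x = polyAt p x - polyAt q x := by
  simp [polyAt]

theorem polyAt_mul (p q : Poly2) (x : Plane) : polyAt (p * q) x = polyAt p x * polyAt q x := by
  simp [polyAt]

theorem polyAt_pow (p : Poly2) (n : ℕ) (x : Plane) : polyAt (p ^ n) x = polyAt p x ^ n := by
  simp [polyAt]

theorem polyAt_sum {ι : Type*} (s : Finset ι) (p : ι → Poly2) (x : Plane) :
    polyAt (∑ i ∈ s, p i) x = ∑ i ∈ s, polyAt (p i) x := by
  simp [polyAt]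

theorem polyAt_zero (x : Plane) : polyAt 0 x = 0 := by
  simp [polyAt]

theorem contDiff_polyAt (p : Poly2) {n : WithTop ℕ∞} : ContDiff ℝ n (polyAt p) := by
  induction p using MvPolynomial.induction_on with
  | C a => simpa [funext (polyAt_C a)] using contDiff_const
  | add p q hp hq => simpa [funext (polyAt_add p q)] using hp.add hq
  | mul_X p i hp =>
    have h : polyAt (p * MvPolynomial.X i) = fun x => polyAt p x * x i := by
      ext x; rw [polyAt_mul, polyAt_X]
    rw [h]
    exact hp.mul (by fun_prop)

theorem continuous_polyAt (p : Poly2) : Continuous (polyAt p) :=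
  (contDiff_polyAt p (n := 0)).continuous

theorem differentiable_polyAt (p : Poly2) : Differentiable ℝ (polyAt p) :=
  (contDiff_polyAt p (n := 1)).differentiable (by simp)

theorem fderiv_polyAt_single (p : Poly2) (x : Plane) (i : Fin 2) :
    fderiv ℝ (polyAt p) x (EuclideanSpace.single i 1) = polyAt (MvPolynomial.pderiv i p) x := by
  induction p using MvPolynomial.induction_on with
  | C a => simp [funext (polyAt_C a), polyAt_zero]
  | add p q hp hq =>
    rw [funext (polyAt_add p q), fderiv_fun_add (differentiable_polyAt p x)
      (differentiable_polyAt q x)]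
    simp [hp, hq, polyAt_add]
  | mul_X p j hp =>
    have h : polyAt (p * MvPolynomial.X j) = fun x => polyAt p x * x j := by
      ext x; rw [polyAt_mul, polyAt_X]
    have hj : HasFDerivAt (fun x : Plane => x j)
        (EuclideanSpace.proj j : Plane →L[ℝ] ℝ) x :=
      (EuclideanSpace.proj j : Plane →L[ℝ] ℝ).hasFDerivAt
    rw [h, ((differentiable_polyAt p x).hasFDerivAt.fun_mul hj).fderiv]
    by_cases hij : i = j
    · subst hij
      simp [hp, polyAt_add, polyAt_mul, polyAt_X]
    · simp [hp, polyAt_mul, polyAt_X, MvPolynomial.pderiv_X, Ne.symm hij]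

theorem plane_eq_sum_single (w : Plane) : w = ∑ i, w i • EuclideanSpace.single i (1 : ℝ) := by
  ext j
  fin_cases j <;> simp

theorem clm_apply_eq_sum (l : Plane →L[ℝ] ℝ) (w : Plane) :
    l w = ∑ i, w i * l (EuclideanSpace.single i 1) := by
  conv_lhs => rw [plane_eq_sum_single w]
  simp

theorem fderiv_polyAt_apply (p : Poly2) (x w : Plane) :
    fderiv ℝ (polyAt p) x w = ∑ i, w i * polyAt (MvPolynomial.pderiv i p) x := by
  rw [clm_apply_eq_sum]
  simp only [fderiv_polyAt_single]

theorem inner_gradient_apply (u : Plane → ℝ) (x w : Plane) :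
    inner ℝ (gradient u x) w = fderiv ℝ u x w := by
  simp [gradient]

theorem continuous_polyMatAt (Φ : Matrix (Fin 2) (Fin 2) Poly2) : Continuous (polyMatAt Φ) := by
  refine continuous_matrix fun i k => ?_
  exact continuous_polyAt _

theorem weightedField_apply (ρ : Plane → ℝ) (Φ : Matrix (Fin 2) (Fin 2) Poly2)
    (w : Plane → Plane) (x : Plane) (i : Fin 2) :
    weightedField ρ Φ w x i = ρ x * ∑ k, polyAt (Φ i k) x * w x k := by
  fin_cases i <;> simp [weightedField, polyMatAt]

theorem weightedField_polyField_apply (ρ : Plane → ℝ) (Φ : Matrix (Fin 2) (Fin 2) Poly2)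
    (v : Fin 2 → Poly2) (x : Plane) (i : Fin 2) :
    weightedField ρ Φ (polyField v) x i = ρ x * polyAt (∑ k, Φ i k * v k) x := by
  rw [weightedField_apply, polyAt_sum]
  simp [polyAt_mul, polyField]

/-! ### Coprime plane polynomials and vanishing ideals -/

/-- Gauss's lemma: clear denominators in a common divisor over the fraction field; its primitive
part divides both polynomials over `R`, hence is a unit. -/
theorem isRelPrime_map_fractionRing {R : Type*} [CommRing R] [IsDomain R]
    [UniqueFactorizationMonoid R] {p q : Polynomial R} (hp : p ≠ 0) (h : IsRelPrime p q) :
    IsRelPrime (p.map (algebraMap R (FractionRing R))) (q.map (algebraMap R (FractionRing R))) := by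
  have := Classical.arbitrary (NormalizedGCDMonoid R)
  intro d hdp hdq
  have hinj : Function.Injective (algebraMap R (FractionRing R)) := IsFractionRing.injective _ _
  have hd : d ≠ 0 := by
    rintro rfl
    exact hp ((Polynomial.map_eq_zero_iff hinj).1 (zero_dvd_iff.1 hdp))
  set N := IsLocalization.integerNormalization (nonZeroDivisors R) d with hN
  obtain ⟨b, hb, hbd⟩ := IsLocalization.integerNormalization_spec (nonZeroDivisors R) d
  have hbu : IsUnit (Polynomial.C (algebraMap R (FractionRing R) b)) := by
    rw [Polynomial.isUnit_C, isUnit_iff_ne_zero]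
    exact IsFractionRing.to_map_ne_zero_of_mem_nonZeroDivisors hb
  have hbd' : N.map (algebraMap R (FractionRing R)) =
      Polynomial.C (algebraMap R (FractionRing R) b) * d := by
    rw [hbd, Algebra.smul_def, Polynomial.algebraMap_apply]
  have key : N.primPart.map (algebraMap R (FractionRing R)) ∣ d := by
    have h1 : N.primPart.map (algebraMap R (FractionRing R)) ∣
        N.map (algebraMap R (FractionRing R)) :=
      Polynomial.map_dvd _ N.primPart_dvd
    rwa [hbd', hbu.dvd_mul_left] at h1
  have hu : IsUnit N.primPart :=
    h (N.isPrimitive_primPart.dvd_of_fraction_map_dvd_fraction_map (key.trans hdp))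
      (N.isPrimitive_primPart.dvd_of_fraction_map_dvd_fraction_map (key.trans hdq))
  exact Polynomial.isUnit_or_eq_zero_of_isUnit_integerNormalization_primPart hd hu

/-- The constant is the resultant, nonzero because coprimality survives in the fraction field.
Constant `p` is settled by hand, as the resultant identity is invoked with a nonzero degree. -/
theorem exists_mul_add_mul_eq_C_of_isRelPrime {R : Type*} [CommRing R] [IsDomain R]
    [UniqueFactorizationMonoid R] {p q : Polynomial R} (h : IsRelPrime p q) :
    ∃ (a b : Polynomial R) (r : R), r ≠ 0 ∧ p * a + q * b = Polynomial.C r := by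
  by_cases hdeg : p.natDegree = 0
  · obtain ⟨c, rfl⟩ := Polynomial.natDegree_eq_zero.1 hdeg
    by_cases hc : c = 0
    · subst hc
      rw [Polynomial.C_0, isRelPrime_zero_left] at h
      obtain ⟨b, hb⟩ := h.exists_right_inv
      exact ⟨0, b, 1, one_ne_zero, by simp [hb]⟩
    · exact ⟨1, 0, c, hc, by simp⟩
  · have hp : p ≠ 0 := by rintro rfl; simp at hdeg
    obtain ⟨a, b, -, -, hab⟩ :=
      Polynomial.exists_mul_add_mul_eq_C_resultant p q le_rfl le_rfl (Or.inl hdeg)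
    refine ⟨a, b, _, fun h0 => ?_, hab⟩
    have hinj : Function.Injective (algebraMap R (FractionRing R)) := IsFractionRing.injective _ _
    have h1 := Polynomial.resultant_map_map p q p.natDegree q.natDegree
      (algebraMap R (FractionRing R))
    rw [h0, map_zero] at h1
    rw [← Polynomial.natDegree_map_eq_of_injective hinj p,
      ← Polynomial.natDegree_map_eq_of_injective hinj q, Polynomial.resultant_eq_zero_iff] at h1
    exact h1.2 (isRelPrime_map_fractionRing hp h).isCoprime

theorem finite_setOf_eval_eq_zero {r : MvPolynomial (Fin 1) ℝ} (hr : r ≠ 0) :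
    {y : ℝ | MvPolynomial.eval (fun _ => y) r = 0}.Finite := by
  set e := (MvPolynomial.isEmptyRingEquiv ℝ (Fin 0)) with he
  have hev : (MvPolynomial.eval (Fin.elim0 : Fin 0 → ℝ)) = (e : MvPolynomial (Fin 0) ℝ →+* ℝ) := by
    ext a
    · simp [he]
    · exact Fin.elim0 ‹_›
  set P : Polynomial ℝ := (MvPolynomial.finSuccEquiv ℝ 0 r).map
    (MvPolynomial.eval (Fin.elim0 : Fin 0 → ℝ)) with hP
  have hP0 : P ≠ 0 := by
    rw [hP, hev, Ne, Polynomial.map_eq_zero_iff (RingEquiv.injective e)]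
    simpa using hr
  refine (Polynomial.finite_setOfPred_isRoot hP0).subset fun y hy => ?_
  have := MvPolynomial.eval_eq_eval_mv_eval' (Fin.elim0 : Fin 0 → ℝ) y r
  have hc : (Fin.cons y Fin.elim0 : Fin 1 → ℝ) = fun _ => y := by
    ext i; fin_cases i; rfl
  rw [hc] at this
  exact this.symm.trans hy

/-- Elimination of `x 0`: a combination of `p` and `q` is a nonzero polynomial in `x 1` alone, which
must vanish at every common zero. -/
theorem exists_finite_second_coord {p q : Poly2} (h : IsRelPrime p q) :
    ∃ A : Set ℝ, A.Finite ∧ ∀ x : Fin 2 → ℝ, MvPolynomial.eval x p = 0 →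
      MvPolynomial.eval x q = 0 → x 1 ∈ A := by
  set e := MvPolynomial.finSuccEquiv ℝ 1
  have h' : IsRelPrime (e p) (e q) := IsRelPrime.of_map e.symm (by simpa using h)
  obtain ⟨a, b, r, hr, hab⟩ := exists_mul_add_mul_eq_C_of_isRelPrime h'
  refine ⟨_, finite_setOf_eval_eq_zero hr, fun x hp hq => ?_⟩
  have hx : x = Fin.cons (x 0) (fun _ : Fin 1 => x 1) := by
    ext i; fin_cases i <;> rfl
  rw [hx, MvPolynomial.eval_eq_eval_mv_eval'] at hp hq
  have := congrArg (fun s => Polynomial.eval (x 0)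
    (Polynomial.map (MvPolynomial.eval (fun _ : Fin 1 => x 1)) s)) hab
  simp only [Polynomial.map_add, Polynomial.map_mul, Polynomial.eval_add, Polynomial.eval_mul,
    Polynomial.map_C, Polynomial.eval_C] at this
  rw [hp, hq] at this
  simpa using this.symm

theorem exists_finite_first_coord {p q : Poly2} (h : IsRelPrime p q) :
    ∃ A : Set ℝ, A.Finite ∧ ∀ x : Fin 2 → ℝ, MvPolynomial.eval x p = 0 →
      MvPolynomial.eval x q = 0 → x 0 ∈ A := by
  set e := MvPolynomial.renameEquiv ℝ (Equiv.swap (0 : Fin 2) 1)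
  have h' : IsRelPrime (e p) (e q) := IsRelPrime.of_map e.symm (by simpa using h)
  obtain ⟨A, hA, hx⟩ := exists_finite_second_coord h'
  refine ⟨A, hA, fun x hp hq => ?_⟩
  have hc : (x ∘ Equiv.swap (0 : Fin 2) 1) ∘ Equiv.swap (0 : Fin 2) 1 = x := by
    ext i; simp
  have := hx (x ∘ Equiv.swap 0 1)
    (by simpa [e, MvPolynomial.eval_rename, hc] using hp)
    (by simpa [e, MvPolynomial.eval_rename, hc] using hq)
  simpa using this

theorem IsRelPrime.finite_common_zeros {p q : Poly2} (h : IsRelPrime p q) :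
    {x : Plane | polyAt p x = 0 ∧ polyAt q x = 0}.Finite := by
  obtain ⟨A, hA, hxA⟩ := exists_finite_first_coord h
  obtain ⟨B, hB, hxB⟩ := exists_finite_second_coord h
  have hAB : (A ×ˢ B).Finite := hA.prod hB
  refine Set.Finite.of_finite_image (f := fun x : Plane => ((x 0, x 1) : ℝ × ℝ))
    (hAB.subset ?_) ?_
  · rintro _ ⟨x, ⟨hp, hq⟩, rfl⟩
    exact ⟨hxA _ hp hq, hxB _ hp hq⟩
  · intro x _ y _ hxy
    simp only [Prod.mk.injEq] at hxy
    ext i; fin_cases i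
    · exact hxy.1
    · exact hxy.2

/-- The polynomials vanishing on a plane set without isolated points form a principal ideal. -/
theorem exists_generator_of_vanishing {Z : Set Plane} (hZ : ∀ x ∈ Z, AccPt x (𝓟 Z))
    {p₀ : Poly2} (hp₀ : p₀ ≠ 0) (hv : ∀ x ∈ Z, polyAt p₀ x = 0) :
    ∃ f : Poly2, (∀ x ∈ Z, polyAt f x = 0) ∧
      ∀ q : Poly2, (∀ x ∈ Z, polyAt q x = 0) → f ∣ q := by
  obtain ⟨f, ⟨hf0, hfZ⟩, hmin⟩ := WellFounded.has_min
    (wellFounded_dvdNotUnit (α := Poly2))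
    {p | p ≠ 0 ∧ ∀ x ∈ Z, polyAt p x = 0} ⟨p₀, hp₀, hv⟩
  refine ⟨f, hfZ, fun q hq => ?_⟩
  obtain ⟨f', q', d, hfq, hf', hq'⟩ :=
    UniqueFactorizationMonoid.exists_reduced_factors f hf0 q
  have hd0 : d ≠ 0 := by
    rintro rfl; exact hf0 (by rw [← hf', zero_mul])
  -- With `f = d f'` and `q = d q'`, a point of `Z` off the zeros of `d` is one of the finitely many
  -- common zeros of `f'` and `q'`. Every point of `Z` is a limit of others, so `d` vanishes on all
  -- of `Z`, and minimality of `f` makes `f'` a unit.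
  have hdZ : ∀ x ∈ Z, polyAt d x = 0 := by
    intro x hx
    have hfin := hfq.finite_common_zeros
    have hev : ∀ᶠ y in 𝓝[≠] x, y ∉ {x : Plane | polyAt f' x = 0 ∧ polyAt q' x = 0} := by
      have h1 : ({x : Plane | polyAt f' x = 0 ∧ polyAt q' x = 0} \ {x})ᶜ ∈ 𝓝 x :=
        (hfin.subset Set.sdiff_subset).isClosed.isOpen_compl.mem_nhds (by simp)
      filter_upwards [nhdsWithin_le_nhds h1, self_mem_nhdsWithin] with y hy hyx hmem
      exact hy ⟨hmem, hyx⟩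
    have hacc : ∃ᶠ y in 𝓝[≠] x, y ∈ Z := accPt_iff_frequently_nhdsNE.1 (hZ x hx)
    have hfr : ∃ᶠ y in 𝓝 x, y ∈ {y | polyAt d y = 0} := by
      refine ((hacc.and_eventually hev).mono ?_).filter_mono nhdsWithin_le_nhds
      rintro y ⟨hyZ, hy⟩
      by_contra hdy
      refine hy ⟨?_, ?_⟩
      · have := hfZ y hyZ
        rw [← hf', polyAt_mul] at this
        exact (mul_eq_zero.1 this).resolve_left hdy
      · have := hq y hyZ
        rw [← hq', polyAt_mul] at this
        exact (mul_eq_zero.1 this).resolve_left hdy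
    exact (isClosed_eq (continuous_polyAt d) continuous_const).mem_of_frequently_of_tendsto hfr
      tendsto_id
  have hu : IsUnit f' := by
    by_contra hu
    exact hmin d ⟨hd0, hdZ⟩ ⟨hd0, f', hu, hf'.symm⟩
  obtain ⟨w, hw⟩ := hu.exists_right_inv
  refine ⟨w * q', ?_⟩
  rw [← hf', ← hq']
  linear_combination (-d * q') * hw

/-! ### Differential inequalities along curves -/

/-- Picard–Lindelöf with one time `τ` for all nearby starting points and with trajectories confined
to a prescribed ball. The proof goes through the fixed point in `ODE.FunSpace`, whose curves carry
that confinement. -/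
theorem exists_uniform_flow {E : Type*} [NormedAddCommGroup E] [NormedSpace ℝ E] [CompleteSpace E]
    {X : E → E} {x₀ : E} (hX : ContDiffAt ℝ 1 X x₀) {R : ℝ} (hR : 0 < R) :
    ∃ τ > 0, ∃ s > 0, ∀ y ∈ Metric.closedBall x₀ s, ∃ α : ℝ → E, α 0 = y ∧
      ∀ t ∈ Set.Icc 0 τ, α t ∈ Metric.closedBall x₀ R ∧
        HasDerivWithinAt α (X (α t)) (Set.Icc 0 τ) t := by
  obtain ⟨ε, hε, a, r, L, K, hr, hf⟩ := IsPicardLindelof.of_contDiffAt_one hX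
  have ha : 0 < a := by
    have h := (hf 0).mul_max_le
    have h1 : (0 : ℝ) ≤ L * max (0 + ε - 0) (0 - (0 - ε)) :=
      mul_nonneg L.2 (le_max_of_le_left (by linarith))
    have h2 : (0 : ℝ) < r := hr
    have : (0 : ℝ) < a := by simp only at h; linarith
    exact this
  -- Capping the radius by `R` confines the curves; the time is then shrunk so that starting points
  -- within `a' / 2` remain admissible.
  set a' : NNReal := min a ⟨R, hR.le⟩ with ha'
  have ha'0 : 0 < a' := lt_min ha hR
  obtain ⟨ε', hε', hf'⟩ := (hf 0).exists_shrink_radius hε (min_le_left a ⟨R, hR.le⟩)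
    (half_lt_self ha'0)
  refine ⟨ε', hε', a' / 2, by positivity, fun y hy => ?_⟩
  have hy' : y ∈ Metric.closedBall x₀ ((a' / 2 : NNReal) : ℝ) := by simpa using hy
  obtain ⟨α, hα⟩ := ODE.FunSpace.exists_isFixedPt_next hf' hy'
  have hmem : ∀ t, α.compProj t ∈ Metric.closedBall x₀ (a' : ℝ) :=
    fun t => α.compProj_mem_closedBall hf'.mul_max_le
  have hpic : ∀ t ∈ Set.Icc (0 - ε') (0 + ε'),
      α.compProj t = ODE.picard (fun _ => X) 0 y α.compProj t := by
    intro t ht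
    conv_lhs => rw [← hα]
    rw [ODE.FunSpace.compProj_apply, ODE.FunSpace.next_apply, Set.projIcc_of_mem _ ht]
  have h0 : (0 : ℝ) ∈ Set.Icc (0 - ε') (0 + ε') := ⟨by linarith, by linarith⟩
  refine ⟨α.compProj, ?_, fun t ht => ⟨?_, ?_⟩⟩
  · rw [hpic 0 h0]; simp
  · refine Metric.closedBall_subset_closedBall ?_ (hmem t)
    exact_mod_cast min_le_right a ⟨R, hR.le⟩
  · have hsub : Set.Icc 0 ε' ⊆ Set.Icc (0 - ε') (0 + ε') :=
      Set.Icc_subset_Icc (by linarith) (by linarith)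
    have := ODE.hasDerivWithinAt_picard_Icc h0 hf'.continuousOn_uncurry
      α.continuous_compProj.continuousOn (fun t _ => hmem t) y (hsub ht)
    exact (this.congr_of_mem hpic (hsub ht)).mono hsub

/-- A nonnegative solution of `∂_X ρ = -B ρ` stays away from zero at a boundary point at which `X`
points strictly into the domain. -/
theorem exists_pos_le_of_inward_field {E : Type*} [NormedAddCommGroup E] [NormedSpace ℝ E]
    [FiniteDimensional ℝ E] {U : Set E} {x : E} {ρ g B : E → ℝ} {X : E → E}
    (hρ : ∀ y ∈ U, DifferentiableAt ℝ ρ y) (hpos : ∀ y ∈ U, 0 < ρ y)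
    (hg : ContDiffAt ℝ 1 g x) (hgU : ∀ᶠ y in 𝓝 x, (y ∈ U ↔ g y < 0))
    (hX : ContDiffAt ℝ 1 X x) (hgX : fderiv ℝ g x (X x) < 0) (hB : ContinuousAt B x)
    (heq : ∀ y ∈ U, fderiv ℝ ρ y (X y) = -(ρ y * B y)) :
    ∃ m > 0, ∀ᶠ y in 𝓝 x, y ∈ U → m ≤ ρ y := by
  have := FiniteDimensional.complete ℝ E
  have := FiniteDimensional.proper_real E
  -- Half the inward speed at `x`: by continuity `g` still decreases at rate at least `κ` along `X`
  -- nearby.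
  set κ := -fderiv ℝ g x (X x) / 2 with hκ
  have hκ0 : 0 < κ := by rw [hκ]; linarith
  set C := |B x| + 1 with hC
  have hcont : ContinuousAt (fun y => fderiv ℝ g y (X y)) x :=
    (hg.fderiv_right (m := 0) (by simp)).continuousAt.clm_apply hX.continuousAt
  have h1 : ∀ᶠ y in 𝓝 x, fderiv ℝ g y (X y) < -κ :=
    hcont.eventually_lt continuousAt_const (by rw [hκ]; linarith)
  have h2 : ∀ᶠ y in 𝓝 x, |B y| < C := hB.abs.eventually_lt continuousAt_const (by rw [hC]; linarith)
  have h3 : ∀ᶠ y in 𝓝 x, ContDiffAt ℝ 1 g y := hg.eventually (by simp)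
  obtain ⟨R, hR, hball⟩ := Metric.nhds_basis_closedBall.eventually_iff.1
    (h1.and (h2.and (h3.and hgU)))
  obtain ⟨τ, hτ, s, hs, hflow⟩ := exists_uniform_flow hX hR
  -- The compact subset of `U` that every trajectory has entered by time `τ`; `ρ` has a positive
  -- minimum on it.
  set K := Metric.closedBall x R ∩ {y | g y ≤ -κ * τ} with hK
  have hgc : ContinuousOn g (Metric.closedBall x R) := fun y hy =>
    (hball hy).2.2.1.continuousAt.continuousWithinAt
  have hKc : IsCompact K := by
    have : IsClosed K := hgc.preimage_isClosed_of_isClosed Metric.isClosed_closedBall isClosed_Iic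
    exact (isCompact_closedBall x R).of_isClosed_subset this Set.inter_subset_left
  have hKU : K ⊆ U := fun y hy => (hball hy.1).2.2.2.2 (hy.2.trans_lt (by nlinarith))
  obtain ⟨m, hm, hmK⟩ : ∃ m > 0, ∀ y ∈ K, m ≤ ρ y := by
    rcases K.eq_empty_or_nonempty with h | h
    · exact ⟨1, one_pos, by simp [h]⟩
    · obtain ⟨z, hz, hmin⟩ := hKc.exists_isMinOn h
        (fun y hy => (hρ y (hKU hy)).continuousAt.continuousWithinAt)
      exact ⟨ρ z, hpos z (hKU hz), fun y hy => hmin hy⟩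
  refine ⟨Real.exp (-C * τ) * m, by positivity, ?_⟩
  filter_upwards [Metric.closedBall_mem_nhds x hs, Metric.closedBall_mem_nhds x hR] with y hys hyR hyU
  obtain ⟨α, hα0, hα⟩ := hflow y hys
  have hαc : ContinuousOn α (Set.Icc 0 τ) := fun t ht => (hα t ht).2.continuousWithinAt
  have hαd : ∀ t ∈ Set.Ioo 0 τ, HasDerivAt α (X (α t)) t := fun t ht =>
    (hα t (Set.Ioo_subset_Icc_self ht)).2.hasDerivAt (Icc_mem_nhds ht.1 ht.2)
  have hgα : ∀ t ∈ Set.Icc 0 τ, g (α t) + κ * t ≤ g y := by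
    have hanti : AntitoneOn (fun t => g (α t) + κ * t) (Set.Icc 0 τ) := by
      have hd : ∀ t ∈ Set.Ioo 0 τ, HasDerivAt (fun t => g (α t) + κ * t)
          (fderiv ℝ g (α t) (X (α t)) + κ * 1) t := fun t ht =>
        (((hball (hα t (Set.Ioo_subset_Icc_self ht)).1).2.2.1.differentiableAt
          (by simp)).hasFDerivAt.comp_hasDerivAt t (hαd t ht)).add
          ((hasDerivAt_id t).const_mul κ)
      refine antitoneOn_of_deriv_nonpos (convex_Icc 0 τ) ?_ ?_ ?_
      · exact (hgc.comp hαc fun t ht => (hα t ht).1).add (by fun_prop)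
      · rw [interior_Icc]
        exact fun t ht => (hd t ht).differentiableAt.differentiableWithinAt
      · rw [interior_Icc]
        intro t ht
        rw [(hd t ht).deriv]
        have := (hball (hα t (Set.Ioo_subset_Icc_self ht)).1).1
        linarith
    intro t ht
    have := hanti (Set.left_mem_Icc.2 hτ.le) ht ht.1
    simpa [hα0] using this
  have hgy : g y < 0 := (hball hyR).2.2.2.1 hyU
  have hαU : ∀ t ∈ Set.Icc 0 τ, α t ∈ U := fun t ht => by
    have := hgα t ht
    exact (hball (hα t ht).1).2.2.2.2 (by nlinarith [ht.1])
  have hαK : α τ ∈ K := ⟨(hα τ ⟨hτ.le, le_rfl⟩).1, by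
    have := hgα τ ⟨hτ.le, le_rfl⟩
    show g (α τ) ≤ -κ * τ
    linarith⟩
  -- The derivative is `-exp(-Ct) ρ (C + B) ≤ 0` since `|B| < C`. Comparing times `0` and `τ`
  -- carries the bound on `K` back to `y`.
  have hanti : AntitoneOn (fun t => Real.exp (-C * t) * ρ (α t)) (Set.Icc 0 τ) := by
    have hd : ∀ t ∈ Set.Ioo 0 τ, HasDerivAt (fun t => Real.exp (-C * t) * ρ (α t))
        (Real.exp (-C * t) * (-C * 1) * ρ (α t) +
          Real.exp (-C * t) * fderiv ℝ ρ (α t) (X (α t))) t := fun t ht =>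
      (((hasDerivAt_id t).const_mul (-C)).exp).mul
        ((hρ _ (hαU t (Set.Ioo_subset_Icc_self ht))).hasFDerivAt.comp_hasDerivAt t (hαd t ht))
    refine antitoneOn_of_deriv_nonpos (convex_Icc 0 τ) ?_ ?_ ?_
    · refine (by fun_prop : Continuous fun t => Real.exp (-C * t)).continuousOn.mul ?_
      intro t ht
      exact (hρ _ (hαU t ht)).continuousAt.comp_continuousWithinAt (hαc t ht)
    · rw [interior_Icc]
      exact fun t ht => (hd t ht).differentiableAt.differentiableWithinAt
    · rw [interior_Icc]
      intro t ht
      have ht' := Set.Ioo_subset_Icc_self ht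
      rw [(hd t ht).deriv, heq _ (hαU t ht')]
      have hb := (abs_lt.1 (hball (hα t ht').1).2.1).1
      have hp := hpos _ (hαU t ht')
      have : 0 ≤ Real.exp (-C * t) * (ρ (α t) * (C + B (α t))) :=
        mul_nonneg (Real.exp_pos _).le (mul_nonneg hp.le (by linarith))
      linarith
  have := hanti (Set.left_mem_Icc.2 hτ.le) (Set.right_mem_Icc.2 hτ.le) hτ.le
  simp only [hα0, mul_zero, Real.exp_zero, one_mul] at this
  exact (mul_le_mul_of_nonneg_left (hmK _ hαK) (Real.exp_pos _).le).trans this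

/-- A function whose gradient is locally bounded by a multiple of its modulus vanishes near each of
its zeros. -/
theorem eventually_eq_zero_of_norm_fderiv_le {E : Type*} [NormedAddCommGroup E] [NormedSpace ℝ E]
    {f : E → ℝ} {x : E} {C : ℝ} (hf : ∀ᶠ y in 𝓝 x, DifferentiableAt ℝ f y)
    (hC : ∀ᶠ y in 𝓝 x, ‖fderiv ℝ f y‖ ≤ C * |f y|) (h0 : f x = 0) :
    ∀ᶠ y in 𝓝 x, f y = 0 := by
  obtain ⟨r, hr, hball⟩ := Metric.nhds_basis_ball.eventually_iff.1 (hf.and hC)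
  filter_upwards [Metric.ball_mem_nhds x hr] with y hy
  have hmem : ∀ t ∈ Set.Icc (0 : ℝ) 1, x + t • (y - x) ∈ Metric.ball x r := by
    intro t ht
    exact (convex_ball x r).add_smul_sub_mem (Metric.mem_ball_self hr) hy ht
  have hline : ∀ t : ℝ, HasDerivAt (fun t : ℝ => x + t • (y - x)) (y - x) t := fun t => by
    simpa using ((hasDerivAt_id t).smul_const (y - x)).const_add x
  have hd : ∀ t ∈ Set.Icc (0 : ℝ) 1, HasDerivAt (fun t : ℝ => f (x + t • (y - x)))
      (fderiv ℝ f (x + t • (y - x)) (y - x)) t := fun t ht =>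
    (hball (hmem t ht)).1.hasFDerivAt.comp_hasDerivAt t (hline t)
  -- Grönwall on the segment from `x` to `y`.
  have := eq_zero_of_abs_deriv_le_mul_abs_self_of_eq_zero_right
    (f := fun t : ℝ => f (x + t • (y - x))) (K := C * ‖y - x‖) (a := 0) (b := 1)
    (fun t ht => (hd t ht).continuousAt.continuousWithinAt)
    (fun t ht => (hd t (Set.Ico_subset_Icc_self ht)).hasDerivWithinAt) (by simpa using h0)
    (fun t ht => by
      refine (ContinuousLinearMap.le_opNorm _ _).trans ?_
      have := (hball (hmem t (Set.Ico_subset_Icc_self ht))).2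
      rw [Real.norm_eq_abs, mul_right_comm]
      gcongr) 1 (by simp)
  simpa using this

/-! ### Regularity and positivity of the weight from the Pearson equation -/

theorem polyAt_det (Φ : Matrix (Fin 2) (Fin 2) Poly2) (x : Plane) :
    polyAt Φ.det x = (polyMatAt Φ x).det := by
  rw [Matrix.det_fin_two, Matrix.det_fin_two, polyAt_sub, polyAt_mul, polyAt_mul]
  rfl

/-- The product rule moves the divergence of `Φ` to the right: `b = ψ - div Φ`. -/
theorem PearsonEquation.exists_poly {Ω : Set Plane} {ρ : Plane → ℝ}
    {Φ : Matrix (Fin 2) (Fin 2) Poly2} (hopen : IsOpen Ω) (h : PearsonEquation Ω ρ Φ) :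
    ∃ b : Fin 2 → Poly2, ∀ x ∈ Ω, ∀ i,
      ∑ k, fderiv ℝ ρ x (EuclideanSpace.single k 1) * polyAt (Φ k i) x =
        ρ x * polyAt (b i) x := by
  obtain ⟨hd, D, E, -, heq⟩ := h
  refine ⟨fun i => ∑ k, MvPolynomial.X k * MvPolynomial.C (D k i) + MvPolynomial.C (E i) -
    ∑ k, MvPolynomial.pderiv k (Φ k i), fun x hx i => ?_⟩
  have hdx : DifferentiableAt ℝ ρ x := (hd x hx).differentiableAt (hopen.mem_nhds hx)
  have hdiv := heq x hx i
  have hk : ∀ k, fderiv ℝ (fun y => ρ y * polyMatAt Φ y k i) x (EuclideanSpace.single k 1) =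
      ρ x * polyAt (MvPolynomial.pderiv k (Φ k i)) x +
        polyAt (Φ k i) x * fderiv ℝ ρ x (EuclideanSpace.single k 1) := by
    intro k
    have : (fun y => ρ y * polyMatAt Φ y k i) = fun y => ρ y * polyAt (Φ k i) y := rfl
    rw [this, (hdx.hasFDerivAt.fun_mul (differentiable_polyAt (Φ k i) x).hasFDerivAt).fderiv]
    simp [fderiv_polyAt_single]
  have hdiv' : ∑ k, fderiv ℝ (fun y => ρ y * polyMatAt Φ y k i) x (EuclideanSpace.single k 1) =
      ρ x * ((∑ k : Fin 2, x k * D k i) + E i) := hdiv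
  simp only [hk] at hdiv'
  simp only [polyAt_sub, polyAt_add, polyAt_mul, polyAt_X, polyAt_C,
    Fin.sum_univ_two] at hdiv' ⊢
  linear_combination hdiv'

section Weight

variable {Ω : Set Plane} {ρ : Plane → ℝ} {Φ : Matrix (Fin 2) (Fin 2) Poly2} {b : Fin 2 → Poly2}

/-- Cramer's rule: the logarithmic derivative of `ρ` is rational with denominator `det Φ`, which has
no zero in `Ω`. -/
theorem exists_fderiv_eq_smul (hpd : ∀ x ∈ Ω, (polyMatAt Φ x).PosDef)
    (hb : ∀ x ∈ Ω, ∀ i, ∑ k, fderiv ℝ ρ x (EuclideanSpace.single k 1) * polyAt (Φ k i) x =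
      ρ x * polyAt (b i) x) :
    ∃ A : Plane → Plane →L[ℝ] ℝ, ContinuousOn A Ω ∧ ∀ x ∈ Ω, fderiv ℝ ρ x = ρ x • A x := by
  let c : Fin 2 → Poly2 := ![b 0 * Φ 1 1 - b 1 * Φ 1 0, b 1 * Φ 0 0 - b 0 * Φ 0 1]
  have hδ : ∀ x ∈ Ω, polyAt Φ.det x ≠ 0 := fun x hx => by
    rw [polyAt_det]; exact (hpd x hx).det_pos.ne'
  refine ⟨fun x => ∑ k, (polyAt (c k) x / polyAt Φ.det x) •
    (EuclideanSpace.proj k : Plane →L[ℝ] ℝ), ?_, fun x hx => ?_⟩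
  · refine continuousOn_finsetSum _ fun k _ => ContinuousOn.fun_smul ?_ continuousOn_const
    exact (continuous_polyAt _).continuousOn.div (continuous_polyAt _).continuousOn hδ
  · have h0 := hb x hx 0
    have h1 := hb x hx 1
    have hδx := hδ x hx
    have hdet : polyAt Φ.det x =
        polyAt (Φ 0 0) x * polyAt (Φ 1 1) x - polyAt (Φ 0 1) x * polyAt (Φ 1 0) x := by
      rw [Matrix.det_fin_two, polyAt_sub, polyAt_mul, polyAt_mul]
    have hk : ∀ k, fderiv ℝ ρ x (EuclideanSpace.single k 1) =
        ρ x * (polyAt (c k) x / polyAt Φ.det x) := by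
      rw [Fin.sum_univ_two] at h0 h1
      rw [Fin.forall_fin_two]
      constructor
      · rw [← mul_div_assoc, eq_div_iff hδx, hdet]
        simp only [c, Matrix.cons_val_zero, polyAt_sub, polyAt_mul]
        linear_combination polyAt (Φ 1 1) x * h0 - polyAt (Φ 1 0) x * h1
      · rw [← mul_div_assoc, eq_div_iff hδx, hdet]
        simp only [c, Matrix.cons_val_one, Matrix.cons_val_zero, polyAt_sub, polyAt_mul]
        linear_combination polyAt (Φ 0 0) x * h1 - polyAt (Φ 0 1) x * h0
    ext w
    rw [clm_apply_eq_sum, Finset.sum_congr rfl fun k _ => by rw [hk k]]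
    simp only [_root_.smul_apply, _root_.sum_apply, smul_eq_mul,
      Finset.mul_sum, PiLp.proj_apply]
    exact Finset.sum_congr rfl fun k _ => by ring

theorem contDiffOn_of_fderiv_eq_smul (hopen : IsOpen Ω) (hd : DifferentiableOn ℝ ρ Ω)
    {A : Plane → Plane →L[ℝ] ℝ} (hA : ContinuousOn A Ω)
    (hρA : ∀ x ∈ Ω, fderiv ℝ ρ x = ρ x • A x) : ContDiffOn ℝ 1 ρ Ω := by
  rw [show (1 : WithTop ℕ∞) = 0 + 1 from rfl, contDiffOn_succ_iff_fderiv_of_isOpen hopen]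
  refine ⟨hd, by simp, contDiffOn_zero.2 ?_⟩
  exact (hd.continuousOn.smul hA).congr hρA

/-- A point with `ρ ≤ 0` would have a whole neighbourhood with `ρ ≤ 0`, by continuity if `ρ < 0` and
by uniqueness for `∇ρ = ρ A` if `ρ = 0`. That set has positive measure. -/
theorem pos_of_fderiv_eq_smul (hopen : IsOpen Ω) (hd : DifferentiableOn ℝ ρ Ω)
    (hpos : ∀ᵐ x ∂(volume.restrict Ω), 0 < ρ x) {A : Plane → Plane →L[ℝ] ℝ}
    (hA : ContinuousOn A Ω) (hρA : ∀ x ∈ Ω, fderiv ℝ ρ x = ρ x • A x) :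
    ∀ x ∈ Ω, 0 < ρ x := by
  intro x hx
  by_contra! hle
  have hΩ : ∀ᶠ y in 𝓝 x, y ∈ Ω := hopen.mem_nhds hx
  have hev : ∀ᶠ y in 𝓝 x, ρ y ≤ 0 := by
    rcases hle.lt_or_eq with hlt | h0
    · exact ((hd x hx).differentiableAt (hopen.mem_nhds hx)).continuousAt.eventually_lt
        continuousAt_const hlt |>.mono fun y hy => hy.le
    · refine (eventually_eq_zero_of_norm_fderiv_le (C := ‖A x‖ + 1)
        (hΩ.mono fun y hy => (hd y hy).differentiableAt (hopen.mem_nhds hy)) ?_ h0).mono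
        fun y hy => hy.le
      have hAx : ∀ᶠ y in 𝓝 x, ‖A y‖ < ‖A x‖ + 1 :=
        (hA.continuousAt (hopen.mem_nhds hx)).norm.eventually_lt continuousAt_const (by linarith)
      filter_upwards [hΩ, hAx] with y hy hyA
      rw [hρA y hy, norm_smul, Real.norm_eq_abs, mul_comm]
      gcongr
  obtain ⟨V, hV, hVo, hxV⟩ := eventually_nhds_iff.1 (hev.and hΩ)
  have hVpos : 0 < volume V := hVo.measure_pos _ ⟨x, hxV⟩
  rw [ae_restrict_iff' hopen.measurableSet] at hpos
  have : volume V = 0 := measure_mono_null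
    (fun y hy h => not_lt_of_ge (hV y hy).1 (h (hV y hy).2) :
      V ⊆ {y | ¬(y ∈ Ω → 0 < ρ y)}) (ae_iff.1 hpos)
  exact hVpos.ne' this

end Weight

/-! ### Geometry of the outward normal -/

theorem HasDerivAt.eventually_lt_of_neg {φ : ℝ → ℝ} {d a : ℝ} (h : HasDerivAt φ d a)
    (hd : d < 0) : ∀ᶠ s in 𝓝[>] a, φ s < φ a := by
  have h1 := (hasDerivAt_iff_tendsto_slope.1 h).eventually_lt_const hd
  have h2 : ∀ᶠ s in 𝓝[>] a, slope φ a s < 0 :=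
    h1.filter_mono (nhdsWithin_mono _ fun s hs => ne_of_gt hs)
  filter_upwards [h2, self_mem_nhdsWithin] with s hs hsa
  have hsa' : 0 < s - a := sub_pos.2 hsa
  rw [slope_def_field, div_neg_iff] at hs
  rcases hs with hs | hs
  · linarith [hs.2]
  · linarith [hs.1]

namespace IsOutwardUnitNormal

variable {U : Set Plane} {x n : Plane}

theorem congr {V : Set Plane} (h : IsOutwardUnitNormal U x n) (hVU : ∀ᶠ y in 𝓝 x, y ∈ V ↔ y ∈ U)
    (hx : x ∈ frontier V) : IsOutwardUnitNormal V x n := by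
  obtain ⟨-, hn, g, hg, hg0, hgn, hgU⟩ := h
  refine ⟨hx, hn, g, hg, hg0, hgn, ?_⟩
  filter_upwards [hVU, hgU] with y h1 h2 using h1.trans h2

theorem eventually_mem (h : IsOutwardUnitNormal U x n) {w : Plane} (hw : inner ℝ n w < 0) :
    ∀ᶠ s in 𝓝[>] (0 : ℝ), x + s • w ∈ U := by
  obtain ⟨-, -, g, hg, hg0, ⟨c, hc, hgc⟩, hgU⟩ := h
  have hl : HasDerivAt (fun s : ℝ => x + s • w) w 0 := by
    simpa using ((hasDerivAt_id (0 : ℝ)).smul_const w).const_add x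
  have hgd : HasFDerivAt g (fderiv ℝ g x) (x + (0 : ℝ) • w) := by
    simpa using (hg.differentiableAt (by simp)).hasFDerivAt
  have hφ := hgd.comp_hasDerivAt (0 : ℝ) hl
  have hd : fderiv ℝ g x w < 0 := by
    rw [← inner_gradient_apply, hgc, inner_smul_left]
    exact mul_neg_of_pos_of_neg hc hw
  have hcont : Tendsto (fun s : ℝ => x + s • w) (𝓝[>] 0) (𝓝 x) := by
    have := hl.continuousAt.tendsto
    simp only [zero_smul, add_zero] at this
    exact this.mono_left nhdsWithin_le_nhds
  filter_upwards [hφ.eventually_lt_of_neg hd, hcont.eventually hgU] with s hs hsU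
  refine hsU.2 ?_
  simpa [hg0] using hs

theorem eventually_notMem (h : IsOutwardUnitNormal U x n) {w : Plane} (hw : 0 < inner ℝ n w) :
    ∀ᶠ s in 𝓝[>] (0 : ℝ), x + s • w ∉ U := by
  obtain ⟨-, -, g, hg, hg0, ⟨c, hc, hgc⟩, hgU⟩ := h
  have hl : HasDerivAt (fun s : ℝ => x + s • w) w 0 := by
    simpa using ((hasDerivAt_id (0 : ℝ)).smul_const w).const_add x
  have hgd : HasFDerivAt g (fderiv ℝ g x) (x + (0 : ℝ) • w) := by
    simpa using (hg.differentiableAt (by simp)).hasFDerivAt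
  have hφ := (hgd.comp_hasDerivAt (0 : ℝ) hl).fun_neg
  have hd : -fderiv ℝ g x w < 0 := by
    rw [← inner_gradient_apply, hgc, inner_smul_left, neg_lt_zero]
    exact mul_pos hc hw
  have hcont : Tendsto (fun s : ℝ => x + s • w) (𝓝[>] 0) (𝓝 x) := by
    have := hl.continuousAt.tendsto
    simp only [zero_smul, add_zero] at this
    exact this.mono_left nhdsWithin_le_nhds
  filter_upwards [hφ.eventually_lt_of_neg hd, hcont.eventually hgU] with s hs hsU hmem
  have h1 := hsU.1 hmem
  simp [hg0] at hs
  linarith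

/-- The boundary is tangent to the orthogonal complement of the normal. -/
theorem eventually_exists_mem_frontier (hU : IsOpen U) (h : IsOutwardUnitNormal U x n)
    {w : Plane} (hw : inner ℝ n w = 0) {ε : ℝ} (hε : 0 < ε) :
    ∀ᶠ s in 𝓝[>] (0 : ℝ), ∃ θ ∈ Set.Icc (-ε) ε, x + s • (w + θ • n) ∈ frontier U := by
  have hnn : inner ℝ n n = (1 : ℝ) := by
    rw [real_inner_self_eq_norm_sq, h.2.1]; norm_num
  have h1 := h.eventually_mem (w := w + (-ε) • n) (by
    rw [inner_add_right, inner_smul_right, hw, hnn]; linarith)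
  have h2 := h.eventually_notMem (w := w + ε • n) (by
    rw [inner_add_right, inner_smul_right, hw, hnn]; linarith)
  filter_upwards [h1, h2] with s hs1 hs2
  by_contra! hcon
  -- This segment runs from a point of `U` to a point outside; if it missed the frontier,
  -- connectedness would keep it in `U`.
  set l : ℝ → Plane := fun θ => x + s • (w + θ • n) with hl
  have hpre : IsPreconnected (l '' Set.Icc (-ε) ε) :=
    isPreconnected_Icc.image _ (by fun_prop)
  have hsub : l '' Set.Icc (-ε) ε ⊆ U := by
    refine hpre.subset_left_of_subset_union hU isClosed_closure.isOpen_compl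
      (disjoint_compl_right.mono_left subset_closure) ?_ ?_
    · rintro _ ⟨θ, hθ, rfl⟩
      by_contra hmem
      rw [Set.mem_union, not_or, Set.notMem_compl_iff] at hmem
      exact hcon θ hθ ⟨hmem.2, by rw [hU.interior_eq]; exact hmem.1⟩
    · exact ⟨l (-ε), ⟨-ε, ⟨le_rfl, by linarith⟩, rfl⟩, hs1⟩
  exact hs2 (hsub ⟨ε, ⟨by linarith, le_rfl⟩, rfl⟩)

/-- Frontier points `x + s (w + θ n)` with `|θ| ≤ ε` are zeros of `f`; the first-order expansion
divided by `s` bounds the derivative along `w` by `O(ε)`. -/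
theorem fderiv_eq_zero_of_vanishing (hU : IsOpen U) (h : IsOutwardUnitNormal U x n)
    {w : Plane} (hw : inner ℝ n w = 0) {f : Plane → ℝ} (hf : DifferentiableAt ℝ f x)
    (hf0 : ∀ y ∈ frontier U, f y = 0) : fderiv ℝ f x w = 0 := by
  set M := |fderiv ℝ f x n| + ‖w‖ + 1 with hM
  have key : ∀ ε ∈ Set.Ioc (0 : ℝ) 1, |fderiv ℝ f x w| ≤ ε * M := by
    rintro ε ⟨hε, hε1⟩
    have hlo := (hasFDerivAt_iff_isLittleO.1 hf.hasFDerivAt).def hε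
    obtain ⟨r, hr, hball⟩ := Metric.nhds_basis_ball.eventually_iff.1 hlo
    have hsmall : ∀ᶠ s in 𝓝[>] (0 : ℝ), s * (‖w‖ + 1) < r := by
      have : Tendsto (fun s : ℝ => s * (‖w‖ + 1)) (𝓝[>] 0) (𝓝 (0 * (‖w‖ + 1))) :=
        ((continuous_id.mul continuous_const).tendsto (0 : ℝ)).mono_left nhdsWithin_le_nhds
      rw [zero_mul] at this
      exact this.eventually_lt_const hr
    obtain ⟨s, ⟨θ, hθ, hmem⟩, hs, hs0⟩ :=
      ((h.eventually_exists_mem_frontier hU hw hε).and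
        (hsmall.and self_mem_nhdsWithin)).exists
    have hs0 : 0 < s := hs0
    have hθ' : |θ| ≤ ε := abs_le.2 hθ
    have hnorm : ‖s • (w + θ • n)‖ ≤ s * (‖w‖ + 1) := by
      rw [norm_smul, Real.norm_eq_abs, abs_of_pos hs0]
      gcongr
      refine (norm_add_le _ _).trans ?_
      rw [norm_smul, h.2.1, mul_one, Real.norm_eq_abs]
      linarith
    have hb := hball (show x + s • (w + θ • n) ∈ Metric.ball x r by
      rw [Metric.mem_ball, dist_eq_norm, add_sub_cancel_left]
      exact hnorm.trans_lt hs)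
    rw [hf0 _ hmem, hf0 _ h.1, add_sub_cancel_left, sub_zero, zero_sub, norm_neg, map_smul,
      map_add, map_smul, norm_smul, norm_smul, Real.norm_eq_abs, Real.norm_eq_abs,
      abs_of_pos hs0, smul_eq_mul, mul_left_comm] at hb
    have hb' := le_of_mul_le_mul_left hb hs0
    have h2 : ‖w + θ • n‖ ≤ ‖w‖ + 1 := by
      refine (norm_add_le _ _).trans ?_
      rw [norm_smul, h.2.1, mul_one, Real.norm_eq_abs]
      linarith
    have h3 : |θ * fderiv ℝ f x n| ≤ ε * |fderiv ℝ f x n| := by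
      rw [abs_mul]; gcongr
    have h4 : ε * ‖w + θ • n‖ ≤ ε * (‖w‖ + 1) := by gcongr
    have h5 : |fderiv ℝ f x w| ≤
        |fderiv ℝ f x w + θ * fderiv ℝ f x n| + |θ * fderiv ℝ f x n| := by
      simpa using abs_sub (fderiv ℝ f x w + θ * fderiv ℝ f x n) (θ * fderiv ℝ f x n)
    rw [hM]
    linarith
  by_contra hne
  have hpos : 0 < |fderiv ℝ f x w| := abs_pos.2 hne
  have hM0 : 0 < M := by positivity
  have hk := key (min 1 (|fderiv ℝ f x w| / (2 * M)))
    ⟨lt_min one_pos (by positivity), min_le_left _ _⟩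
  have : min 1 (|fderiv ℝ f x w| / (2 * M)) * M ≤ |fderiv ℝ f x w| / (2 * M) * M := by
    gcongr; exact min_le_right _ _
  have h2 : |fderiv ℝ f x w| / (2 * M) * M = |fderiv ℝ f x w| / 2 := by field_simp
  linarith

end IsOutwardUnitNormal

/-! ### Degeneracy of the matrix on the boundary and the boundary polynomial -/

theorem quadratic_form_eq (Φ : Matrix (Fin 2) (Fin 2) Poly2) (x n : Plane) :
    n.ofLp ⬝ᵥ (polyMatAt Φ x *ᵥ n.ofLp) =
      ∑ i, n i * ∑ k, polyAt (Φ i k) x * n k := by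
  simp only [dotProduct, Matrix.mulVec, polyMatAt, Matrix.of_apply]

theorem posSemidef_polyMatAt_of_mem_closure {Ω : Set Plane} {Φ : Matrix (Fin 2) (Fin 2) Poly2}
    (hsymm : Φ.IsSymm) (hpd : ∀ x ∈ Ω, (polyMatAt Φ x).PosDef) {x : Plane} (hx : x ∈ closure Ω) :
    (polyMatAt Φ x).PosSemidef := by
  refine Matrix.PosSemidef.of_dotProduct_mulVec_nonneg ?_ fun w => ?_
  · ext i k
    simp [polyMatAt, hsymm.apply i k]
  · have hc : Continuous fun y => star w ⬝ᵥ (polyMatAt Φ y *ᵥ w) :=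
      continuous_const.dotProduct ((continuous_polyMatAt Φ).matrix_mulVec continuous_const)
    exact closure_minimal (fun y hy => (hpd y hy).posSemidef.dotProduct_mulVec_nonneg w)
      (isClosed_le continuous_const hc) hx

/-- Once `j > ‖x‖`, the truncation coincides with `Ω` near `x`, so the limit along the normal does
not depend on `j`; a constant sequence tending to `0` is `0`. -/
theorem NeumannCondition.tendsto_zero {Ω : Set Plane} {ρ : Plane → ℝ}
    {Φ : Matrix (Fin 2) (Fin 2) Poly2} (h : NeumannCondition Ω ρ Φ) {x n : Plane}
    (hn : IsOutwardUnitNormal Ω x n) (p : Poly2) :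
    Tendsto (fun t : ℝ => inner ℝ
      (weightedField ρ Φ (polyField (fun i => MvPolynomial.pderiv i p)) (x - t • n)) n)
      (𝓝[>] 0) (𝓝 0) := by
  obtain ⟨T, hT⟩ := h p
  obtain ⟨h1, h2⟩ := hT x
  have hlarge : ∀ᶠ j : ℕ in atTop, ‖x‖ < j := by
    obtain ⟨N, hN⟩ := exists_nat_gt ‖x‖
    filter_upwards [eventually_ge_atTop N] with j hj
    exact hN.trans_le (by exact_mod_cast hj)
  have hfr : ∀ j : ℕ, ‖x‖ < j → x ∈ frontier (truncation Ω j) := by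
    intro j hj
    have hmem : x ∈ frontier Ω ∩ Metric.ball 0 (j : ℝ) := ⟨hn.1, by simpa using hj⟩
    rw [← frontier_inter_open_inter Metric.isOpen_ball] at hmem
    exact hmem.1
  have hnormal : ∀ j : ℕ, ‖x‖ < j → IsOutwardUnitNormal (truncation Ω j) x n := by
    intro j hj
    refine hn.congr ?_ (hfr j hj)
    filter_upwards [Metric.isOpen_ball.mem_nhds (show x ∈ Metric.ball (0 : Plane) j by simpa using hj)]
      with y hy
    exact ⟨fun h => h.1, fun h => ⟨h, hy⟩⟩
  have hlim : ∀ᶠ j in atTop, Tendsto (fun t : ℝ => inner ℝ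
      (weightedField ρ Φ (polyField (fun i => MvPolynomial.pderiv i p)) (x - t • n)) n)
      (𝓝[>] 0) (𝓝 (T j x)) := by
    filter_upwards [h1, hlarge] with j hj hjx using hj n (hnormal j hjx)
  obtain ⟨j₀, hj₀, -⟩ := (hlim.and hlarge).exists
  have hconst : Tendsto (fun j => (frontier (truncation Ω j)).indicator (T j) x) atTop
      (𝓝 (T j₀ x)) := by
    refine tendsto_const_nhds.congr' ?_
    filter_upwards [hlim, hlarge] with j hj hjx
    rw [Set.indicator_of_mem (hfr j hjx)]
    exact tendsto_nhds_unique hj₀ hj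
  rwa [tendsto_nhds_unique hconst h2] at hj₀

/-- The normal of the boundary lies in the kernel of `Φ`. -/
theorem mulVec_normal_eq_zero {Ω : Set Plane} {ρ : Plane → ℝ}
    {Φ : Matrix (Fin 2) (Fin 2) Poly2} {b : Fin 2 → Poly2} (hsymm : Φ.IsSymm)
    (hpd : ∀ x ∈ Ω, (polyMatAt Φ x).PosDef) (hd : ∀ x ∈ Ω, DifferentiableAt ℝ ρ x)
    (hpos : ∀ x ∈ Ω, 0 < ρ x)
    (hb : ∀ x ∈ Ω, ∀ i, ∑ k, fderiv ℝ ρ x (EuclideanSpace.single k 1) * polyAt (Φ k i) x =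
      ρ x * polyAt (b i) x)
    (hneumann : NeumannCondition Ω ρ Φ) {x n : Plane} (hn : IsOutwardUnitNormal Ω x n) :
    ∀ i, ∑ k, polyAt (Φ i k) x * n k = 0 := by
  have hpsd := posSemidef_polyMatAt_of_mem_closure hsymm hpd (frontier_subset_closure hn.1)
  set q : Plane → ℝ := fun y => ∑ i, n i * ∑ k, polyAt (Φ i k) y * n k with hq
  have hqc : Continuous q := by
    refine continuous_finsetSum _ fun i _ => continuous_const.mul
      (continuous_finsetSum _ fun k _ => (continuous_polyAt _).mul continuous_const)
  have hq0 : 0 ≤ q x := by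
    have := hpsd.dotProduct_mulVec_nonneg n.ofLp
    rwa [star_trivial, quadratic_form_eq] at this
  have hqx : q x = 0 := by
    by_contra hne
    have hqpos : 0 < q x := lt_of_le_of_ne hq0 (Ne.symm hne)
    obtain ⟨-, -, g, hg, hg0, ⟨c, hc, hgc⟩, hgU⟩ := id hn
    -- `X = -Φn` satisfies `n·X = -nᵗΦn < 0` at `x`, and by symmetry of `Φ` the Pearson equation
    -- gives `∂_X ρ = -ρ (n·b)`.
    let X : Plane → Plane := fun y => WithLp.toLp 2 fun i => -∑ k, polyAt (Φ i k) y * n k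
    have hX : ContDiff ℝ 1 X := by
      refine contDiff_euclidean.2 fun i => ?_
      exact (ContDiff.sum fun k _ => (contDiff_polyAt _).mul contDiff_const).neg
    have hnX : ∀ y, inner ℝ n (X y) = -q y := by
      intro y
      simp [X, hq, PiLp.inner_apply]
      ring
    obtain ⟨m, hm, hmρ⟩ := exists_pos_le_of_inward_field (X := X) (U := Ω) (ρ := ρ) (g := g)
      (x := x) (B := fun y => ∑ i, n i * polyAt (b i) y) hd hpos hg hgU hX.contDiffAt
      (by rw [← inner_gradient_apply, hgc, inner_smul_left, hnX]
          exact mul_neg_of_pos_of_neg hc (by linarith))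
      (continuous_finsetSum _ fun i _ => continuous_const.mul (continuous_polyAt _)).continuousAt
      (by
        intro y hy
        have h0 := hb y hy 0
        have h1 := hb y hy 1
        rw [clm_apply_eq_sum]
        simp only [X, Fin.sum_univ_two] at h0 h1 ⊢
        rw [hsymm.apply 0 1] at h0
        rw [← hsymm.apply 0 1] at h1 ⊢
        rw [hsymm.apply 0 1] at h1 ⊢
        linear_combination (-n 0) * h0 - n 1 * h1)
    -- The linear form `n·y` has gradient `n`, which turns the Neumann condition into `ρ nᵗΦn → 0`.
    have hlim := hneumann.tendsto_zero hn (∑ i, MvPolynomial.C (n i) * MvPolynomial.X i)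
    have hval : ∀ y, inner ℝ (weightedField ρ Φ (polyField (fun i => MvPolynomial.pderiv i
        (∑ i, MvPolynomial.C (n i) * MvPolynomial.X i))) y) n = ρ y * q y := by
      intro y
      have hpd : ∀ k : Fin 2, polyField (fun i => MvPolynomial.pderiv i
          (∑ i, MvPolynomial.C (n i) * MvPolynomial.X i : Poly2)) y k = n k := by
        intro k
        fin_cases k <;> simp [polyField, polyAt, MvPolynomial.pderiv_X]
      simp only [PiLp.inner_apply, weightedField_apply, hpd, hq]
      simp
      ring
    simp only [hval] at hlim
    have hmem : ∀ᶠ t in 𝓝[>] (0 : ℝ), x - t • n ∈ Ω := by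
      have := hn.eventually_mem (w := -n) (by
        rw [inner_neg_right, real_inner_self_eq_norm_sq, hn.2.1]; norm_num)
      simpa [sub_eq_add_neg] using this
    have hcont : Tendsto (fun t : ℝ => x - t • n) (𝓝[>] 0) (𝓝 x) := by
      have : Continuous fun t : ℝ => x - t • n := by fun_prop
      simpa using (this.tendsto 0).mono_left nhdsWithin_le_nhds
    have hqev : ∀ᶠ y in 𝓝 x, q x / 2 < q y :=
      continuousAt_const.eventually_lt hqc.continuousAt (by linarith)
    have hge : m * (q x / 2) ≤ 0 := by
      refine ge_of_tendsto hlim ?_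
      filter_upwards [hmem, hcont.eventually hmρ, hcont.eventually hqev] with t h1 h2 h3
      have := h2 h1
      exact mul_le_mul this h3.le (by positivity) (hpos _ h1).le
    have : 0 < m * (q x / 2) := by positivity
    linarith
  have h0 := (hpsd.dotProduct_mulVec_zero_iff n.ofLp).1 (by
    rw [star_trivial, quadratic_form_eq]; exact hqx)
  intro i
  have := congrFun h0 i
  simpa [Matrix.mulVec, dotProduct, polyMatAt] using this

/-- The frontier has no isolated point and its regular points are dense. At a corner, follow an arc:
it leaves the corner injectively and meets no other corner nearby. At a regular point, move along
the tangent. -/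
theorem HasPiecewiseC1Boundary.frequently_normal {Ω : Set Plane} (hopen : IsOpen Ω)
    (h : HasPiecewiseC1Boundary Ω) {x : Plane} (hx : x ∈ frontier Ω) :
    (∃ᶠ y in 𝓝[≠] x, y ∈ frontier Ω) ∧ ∃ᶠ y in 𝓝 x, ∃ n, IsOutwardUnitNormal Ω y n := by
  obtain ⟨S, hSfr, hSfin, hreg, hcorner⟩ := h
  by_cases hxS : x ∈ S
  · obtain ⟨k, γ, hγ, hev⟩ := hcorner x hxS
    obtain ⟨i, -⟩ := hev.self_of_nhds.1 hx
    obtain ⟨hγ0, hinj, hγc, -⟩ := hγ i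
    have hSiso : ∀ᶠ y in 𝓝 x, y ∈ S → y = x := by
      have hfin : ((S ∩ Metric.closedBall 0 (‖x‖ + 1)) \ {x}).Finite :=
        (hSfin (‖x‖ + 1)).subset Set.sdiff_subset
      have h1 : ((S ∩ Metric.closedBall 0 (‖x‖ + 1)) \ {x})ᶜ ∈ 𝓝 x :=
        hfin.isClosed.isOpen_compl.mem_nhds (by simp)
      have h2 : Metric.closedBall (0 : Plane) (‖x‖ + 1) ∈ 𝓝 x := by
        refine mem_of_superset (Metric.ball_mem_nhds x one_pos) fun y hy => ?_
        rw [mem_closedBall_zero_iff]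
        rw [mem_ball_iff_norm] at hy
        have := norm_le_norm_add_norm_sub' y x
        linarith
      filter_upwards [h1, h2] with y hy1 hy2 hyS
      by_contra hyx
      exact hy1 ⟨⟨hyS, hy2⟩, hyx⟩
    have hIoc : Set.Ioc (0 : ℝ) 1 ∈ 𝓝[>] (0 : ℝ) := Ioc_mem_nhdsGT one_pos
    have hcont : Tendsto (γ i) (𝓝[>] 0) (𝓝[≠] x) := by
      refine tendsto_nhdsWithin_iff.2 ⟨?_, ?_⟩
      · have h1 := hγc.continuousOn 0 ⟨le_rfl, zero_le_one⟩
        rw [ContinuousWithinAt, hγ0] at h1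
        refine h1.mono_left (nhdsWithin_le_iff.2 ?_)
        exact mem_of_superset hIoc Set.Ioc_subset_Icc_self
      · filter_upwards [hIoc] with t ht heq
        have := hinj (Set.Ioc_subset_Icc_self ht) ⟨le_rfl, zero_le_one⟩ (heq.trans hγ0.symm)
        exact ht.1.ne' this
    have hmain : ∃ᶠ y in 𝓝[≠] x, y ∈ frontier Ω ∧ y ∉ S := by
      refine hcont.frequently (Eventually.frequently ?_)
      filter_upwards [hIoc, hcont.eventually (nhdsWithin_le_nhds hev),
        hcont.eventually (nhdsWithin_le_nhds hSiso), hcont.eventually self_mem_nhdsWithin]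
        with t ht h1 h2 h3
      exact ⟨h1.2 ⟨i, t, Set.Ioc_subset_Icc_self ht, rfl⟩, fun hS => h3 (h2 hS)⟩
    exact ⟨hmain.mono fun y hy => hy.1,
      (hmain.filter_mono nhdsWithin_le_nhds).mono fun y hy => hreg y hy⟩
  · obtain ⟨n, hn⟩ := hreg x ⟨hx, hxS⟩
    refine ⟨?_, (Eventually.frequently (f := pure x) (by simpa using ⟨n, hn⟩)).filter_mono
      (pure_le_nhds x)⟩
    let w : Plane := WithLp.toLp 2 ![-n 1, n 0]
    have hnw : inner ℝ n w = 0 := by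
      simp [PiLp.inner_apply, w]; ring
    have hww : inner ℝ w w = (1 : ℝ) := by
      have h1 : inner ℝ n n = (1 : ℝ) := by rw [real_inner_self_eq_norm_sq, hn.2.1]; norm_num
      rw [PiLp.inner_apply, Fin.sum_univ_two] at h1 ⊢
      simp only [w, RCLike.inner_apply, conj_trivial, Matrix.cons_val_zero,
        Matrix.cons_val_one] at h1 ⊢
      linarith
    intro hev
    rw [eventually_nhdsWithin_iff] at hev
    obtain ⟨r, hr, hball⟩ := Metric.nhds_basis_ball.eventually_iff.1 hev
    have hsmall : ∀ᶠ s in 𝓝[>] (0 : ℝ), s * (‖w‖ + 1) < r := by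
      have : Tendsto (fun s : ℝ => s * (‖w‖ + 1)) (𝓝[>] 0) (𝓝 (0 * (‖w‖ + 1))) :=
        ((continuous_id.mul continuous_const).tendsto (0 : ℝ)).mono_left nhdsWithin_le_nhds
      rw [zero_mul] at this
      exact this.eventually_lt_const hr
    obtain ⟨s, ⟨θ, hθ, hmem⟩, hs, hs0⟩ :=
      ((hn.eventually_exists_mem_frontier hopen hnw one_pos).and
        (hsmall.and self_mem_nhdsWithin)).exists
    have hs0 : 0 < s := hs0
    refine hball (show x + s • (w + θ • n) ∈ Metric.ball x r from ?_) ?_ hmem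
    · rw [Metric.mem_ball, dist_eq_norm, add_sub_cancel_left, norm_smul, Real.norm_eq_abs,
        abs_of_pos hs0]
      refine lt_of_le_of_lt ?_ hs
      gcongr
      refine (norm_add_le _ _).trans ?_
      rw [norm_smul, hn.2.1, mul_one, Real.norm_eq_abs]
      have := abs_le.2 hθ
      linarith
    · intro heq
      have h0 : s • (w + θ • n) = 0 := by simpa using heq
      have h1 := (smul_eq_zero.1 h0).resolve_left hs0.ne'
      have h2 : inner ℝ w (w + θ • n) = (1 : ℝ) := by
        rw [inner_add_right, inner_smul_right, hww, real_inner_comm, hnw]; ring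
      rw [h1, inner_zero_right] at h2
      exact zero_ne_one h2

/-- A polynomial that cuts out the boundary and is compatible with `Φ`. -/
theorem exists_boundary_polynomial {Ω : Set Plane} {ρ : Plane → ℝ}
    {Φ : Matrix (Fin 2) (Fin 2) Poly2} {b : Fin 2 → Poly2} (hopen : IsOpen Ω) (hne : Ω.Nonempty)
    (hbd : HasPiecewiseC1Boundary Ω) (hsymm : Φ.IsSymm)
    (hpd : ∀ x ∈ Ω, (polyMatAt Φ x).PosDef) (hd : ∀ x ∈ Ω, DifferentiableAt ℝ ρ x)
    (hpos : ∀ x ∈ Ω, 0 < ρ x)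
    (hb : ∀ x ∈ Ω, ∀ i, ∑ k, fderiv ℝ ρ x (EuclideanSpace.single k 1) * polyAt (Φ k i) x =
      ρ x * polyAt (b i) x)
    (hneumann : NeumannCondition Ω ρ Φ) :
    ∃ f : Poly2, (∀ x ∈ frontier Ω, polyAt f x = 0) ∧ (∀ x ∈ Ω, polyAt f x ≠ 0) ∧
      ∀ i, f ∣ ∑ k, Φ i k * MvPolynomial.pderiv k f := by
  have hker : ∀ x n, IsOutwardUnitNormal Ω x n → ∀ i, ∑ k, polyAt (Φ i k) x * n k = 0 :=
    fun x n hn => mulVec_normal_eq_zero hsymm hpd hd hpos hb hneumann hn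
  have hdense : ∀ p : Poly2, (∀ x n, IsOutwardUnitNormal Ω x n → polyAt p x = 0) →
      ∀ x ∈ frontier Ω, polyAt p x = 0 := by
    intro p hp x hx
    have hfr : ∃ᶠ y in 𝓝 x, y ∈ {y | polyAt p y = 0} :=
      (hbd.frequently_normal hopen hx).2.mono fun y ⟨n, hn⟩ => hp y n hn
    exact (isClosed_eq (continuous_polyAt p) continuous_const).mem_of_frequently_of_tendsto hfr
      tendsto_id
  have hdetΩ : ∀ x ∈ Ω, polyAt Φ.det x ≠ 0 := fun x hx => by
    rw [polyAt_det]; exact (hpd x hx).det_pos.ne'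
  have hdet0 : Φ.det ≠ 0 := by
    intro h
    obtain ⟨x, hx⟩ := hne
    exact hdetΩ x hx (by rw [h, polyAt_zero])
  have hdetfr : ∀ x ∈ frontier Ω, polyAt Φ.det x = 0 := by
    refine hdense _ fun x n hn => ?_
    rw [polyAt_det]
    refine Matrix.exists_mulVec_eq_zero_iff.1 ⟨n.ofLp, fun h => ?_, funext fun i => ?_⟩
    · have : n = 0 := by ext i; exact congrFun h i
      have h1 := hn.2.1
      rw [this, norm_zero] at h1
      exact zero_ne_one h1
    · simpa [Matrix.mulVec, dotProduct, polyMatAt] using hker x n hn i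
  obtain ⟨f, hf, hdvd⟩ := exists_generator_of_vanishing
    (fun x hx => accPt_iff_frequently_nhdsNE.2 (hbd.frequently_normal hopen hx).1) hdet0 hdetfr
  refine ⟨f, hf, fun x hx h0 => ?_, fun i => hdvd _ (hdense _ fun x n hn => ?_)⟩
  · obtain ⟨c, hc⟩ := hdvd _ hdetfr
    exact hdetΩ x hx (by rw [hc, polyAt_mul, h0, zero_mul])
  -- Row `i` of `Φ` is orthogonal to `n`, hence tangent to the boundary, where `f` vanishes.
  · have h1 := hn.fderiv_eq_zero_of_vanishing hopen
      (w := WithLp.toLp 2 fun k => polyAt (Φ i k) x) (by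
        rw [PiLp.inner_apply]
        simpa [mul_comm] using hker x n hn i)
      (differentiable_polyAt f x) hf
    rw [fderiv_polyAt_apply] at h1
    rw [polyAt_sum]
    simpa [polyAt_mul] using h1

/-! ### Compactly supported fields, smooth step and integrability -/

/-- Extended by zero, `V` is `C¹` with compact support on the whole space; integrate by parts
against the constant `1`. -/
theorem integrableOn_fderiv_and_integral_eq_zero {E : Type*} [NormedAddCommGroup E]
    [NormedSpace ℝ E] [FiniteDimensional ℝ E] [MeasurableSpace E] [BorelSpace E]
    {μ : Measure E} [μ.IsAddHaarMeasure] {U : Set E} (hU : IsOpen U) {V : E → ℝ}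
    (hV : ContDiffOn ℝ 1 V U) (hfr : ∀ x ∈ frontier U, ∀ᶠ y in 𝓝 x, V y = 0) {R : ℝ}
    (hR : ∀ x, R < ‖x‖ → V x = 0) (e : E) :
    IntegrableOn (fun x => fderiv ℝ V x e) U μ ∧ ∫ x in U, fderiv ℝ V x e ∂μ = 0 := by
  have := FiniteDimensional.proper_real E
  set G : E → ℝ := U.indicator V with hG
  have hGU : ∀ x ∈ U, G =ᶠ[𝓝 x] V := fun x hx => by
    filter_upwards [hU.mem_nhds hx] with y hy
    exact Set.indicator_of_mem hy _
  have hGU' : ∀ x ∉ U, G =ᶠ[𝓝 x] fun _ => 0 := fun x hx => by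
    by_cases hxc : x ∈ closure U
    · filter_upwards [hfr x ⟨hxc, by rwa [hU.interior_eq]⟩] with y hy
      rw [hG, Set.indicator_apply_eq_zero]
      exact fun _ => hy
    · filter_upwards [isClosed_closure.isOpen_compl.mem_nhds hxc] with y hy
      exact Set.indicator_of_notMem (fun h => hy (subset_closure h)) _
  have hGc : ContDiff ℝ 1 G := by
    rw [contDiff_iff_contDiffAt]
    intro x
    by_cases hx : x ∈ U
    · exact (hV.contDiffAt (hU.mem_nhds hx)).congr_of_eventuallyEq (hGU x hx)
    · exact contDiffAt_const.congr_of_eventuallyEq (hGU' x hx)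
  have hGs : HasCompactSupport G := by
    refine HasCompactSupport.intro (isCompact_closedBall 0 R) fun x hx => ?_
    rw [mem_closedBall_zero_iff, not_le] at hx
    rw [hG, Set.indicator_apply_eq_zero]
    exact fun _ => hR x hx
  have hd : (fun x => fderiv ℝ G x e) = U.indicator fun x => fderiv ℝ V x e := by
    ext x
    by_cases hx : x ∈ U
    · rw [Set.indicator_of_mem hx, (hGU x hx).fderiv_eq]
    · rw [Set.indicator_of_notMem hx, (hGU' x hx).fderiv_eq]
      simp
  have hint : Integrable (fun x => fderiv ℝ G x e) μ := by
    refine Continuous.integrable_of_hasCompactSupport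
      ((hGc.continuous_fderiv (by simp)).clm_apply continuous_const) ?_
    exact (hGs.fderiv ℝ).comp_left (g := fun l : E →L[ℝ] ℝ => l e) (by simp)
  have h0 : ∫ x, fderiv ℝ G x e ∂μ = 0 := by
    have := integral_smul_fderiv_eq_neg_fderiv_smul_of_integrable (μ := μ) (𝕜 := ℝ)
      (f := fun _ : E => (1 : ℝ)) (g := G) (v := e) (by simp) (by simpa using hint)
      (by simpa using hGc.continuous.integrable_of_hasCompactSupport hGs)
      (fun _ _ => differentiableAt_const _) (fun x _ => hGc.differentiable (by simp) x)
    simpa using this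
  rw [hd] at hint h0
  exact ⟨(integrable_indicator_iff hU.measurableSet).1 hint,
    by rwa [integral_indicator hU.measurableSet] at h0⟩

/-- The bound on `t θ'(t)` is the one needed at the boundary, where `t = N f²`. -/
theorem exists_smooth_step : ∃ (θ : ℝ → ℝ) (C : ℝ), ContDiff ℝ 1 θ ∧
    (∀ t, 0 ≤ θ t) ∧ (∀ t, θ t ≤ 1) ∧ (∀ t ≤ 1, θ t = 0) ∧ (∀ t, 2 ≤ t → θ t = 1) ∧
    (∀ t, |deriv θ t| ≤ C) ∧ (∀ t, |t * deriv θ t| ≤ C) := by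
  set θ : ℝ → ℝ := fun t => Real.smoothTransition (t - 1) with hθ
  have hc : ContDiff ℝ 1 θ := Real.smoothTransition.contDiff.comp (contDiff_id.sub contDiff_const)
  have h0 : ∀ t ≤ 1, θ t = 0 := fun t ht => Real.smoothTransition.zero_of_nonpos (by linarith)
  have h1 : ∀ t, 2 ≤ t → θ t = 1 := fun t ht => Real.smoothTransition.one_of_one_le (by linarith)
  have hd : Continuous (deriv θ) := hc.continuous_deriv (by simp)
  have hs : HasCompactSupport (deriv θ) := by
    refine HasCompactSupport.intro (isCompact_Icc (a := (1 : ℝ)) (b := 2)) fun t ht => ?_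
    rw [Set.mem_Icc, not_and_or, not_le, not_le] at ht
    rcases ht with ht | ht
    · have : θ =ᶠ[𝓝 t] fun _ => 0 := by
        filter_upwards [Iio_mem_nhds ht] with s hs using h0 s (le_of_lt hs)
      rw [this.deriv_eq, deriv_const]
    · have : θ =ᶠ[𝓝 t] fun _ => 1 := by
        filter_upwards [Ioi_mem_nhds ht] with s hs using h1 s (le_of_lt hs)
      rw [this.deriv_eq, deriv_const]
  obtain ⟨C₁, hC₁⟩ := hd.bounded_above_of_compact_support hs
  obtain ⟨C₂, hC₂⟩ := (continuous_id.mul hd).bounded_above_of_compact_support hs.mul_left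
  exact ⟨θ, max C₁ C₂, hc, fun t => Real.smoothTransition.nonneg _,
    fun t => Real.smoothTransition.le_one _, h0, h1,
    fun t => (hC₁ t).trans (le_max_left _ _), fun t => (hC₂ t).trans (le_max_right _ _)⟩

theorem IsMomentWeight.integrableOn_poly {Ω : Set Plane} {ρ : Plane → ℝ}
    (h : IsMomentWeight Ω ρ) (p : Poly2) : IntegrableOn (fun x => polyAt p x * ρ x) Ω := by
  have : (fun x => polyAt p x * ρ x) = fun x : Plane =>
      ∑ d ∈ p.support, MvPolynomial.coeff d p * (x 0 ^ d 0 * x 1 ^ d 1 * ρ x) := by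
    ext x
    rw [polyAt, MvPolynomial.eval_eq', Finset.sum_mul]
    refine Finset.sum_congr rfl fun d _ => ?_
    rw [Fin.prod_univ_two]; ring
  rw [this]
  exact integrable_finsetSum _ fun d _ => (h.moments _ _).const_mul _

/-- Domination by `|u p| ≤ u² + p²`; all moments of `ρ` are finite. -/
theorem MemL2Weight.integrableOn_mul_poly {Ω : Set Plane} {ρ u : Plane → ℝ} (hopen : IsOpen Ω)
    (hρ : IsMomentWeight Ω ρ) (hpos : ∀ x ∈ Ω, 0 < ρ x) (hc : ContinuousOn ρ Ω)
    (hu : MemL2Weight Ω ρ u) (p : Poly2) :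
    IntegrableOn (fun x => u x * (ρ x * polyAt p x)) Ω := by
  refine Integrable.mono' (hu.2.add (hρ.integrableOn_poly (p ^ 2))) ?_ ?_
  · exact hu.1.mul ((hc.aestronglyMeasurable hopen.measurableSet).mul
      (continuous_polyAt p).aestronglyMeasurable)
  · refine (ae_restrict_iff' hopen.measurableSet).2 (Eventually.of_forall fun x hx => ?_)
    have hx0 := hpos x hx
    rw [Real.norm_eq_abs, Pi.add_apply, polyAt_pow, abs_le]
    constructor
    · nlinarith [mul_nonneg hx0.le (sq_nonneg (u x + polyAt p x)),
        mul_nonneg hx0.le (sq_nonneg (u x)), mul_nonneg hx0.le (sq_nonneg (polyAt p x))]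
    · nlinarith [mul_nonneg hx0.le (sq_nonneg (u x - polyAt p x)),
        mul_nonneg hx0.le (sq_nonneg (u x)), mul_nonneg hx0.le (sq_nonneg (polyAt p x))]

theorem Matrix.PosSemidef.abs_dotProduct_mulVec_le {ι : Type*} [Fintype ι] {A : Matrix ι ι ℝ}
    (hA : A.PosSemidef) (h v : ι → ℝ) :
    |h ⬝ᵥ (A *ᵥ v)| ≤ h ⬝ᵥ (A *ᵥ h) + v ⬝ᵥ (A *ᵥ v) := by
  have hsymm : v ⬝ᵥ (A *ᵥ h) = h ⬝ᵥ (A *ᵥ v) := by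
    have hT : Aᵀ = A := by simpa using hA.isHermitian.eq
    rw [Matrix.dotProduct_mulVec, ← Matrix.mulVec_transpose, hT, dotProduct_comm]
  have h1 := hA.dotProduct_mulVec_nonneg (h + v)
  have h2 := hA.dotProduct_mulVec_nonneg (h - v)
  have h3 := hA.dotProduct_mulVec_nonneg h
  have h4 := hA.dotProduct_mulVec_nonneg v
  simp only [star_trivial, Matrix.mulVec_add, Matrix.mulVec_sub, add_dotProduct, dotProduct_add,
    sub_dotProduct, dotProduct_sub, hsymm] at h1 h2 h3 h4
  rw [abs_le]
  constructor <;> linarith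

theorem inner_weightedField (ρ : Plane → ℝ) (Φ : Matrix (Fin 2) (Fin 2) Poly2)
    (w : Plane → Plane) (h x : Plane) :
    inner ℝ h (weightedField ρ Φ w x) =
      ρ x * (h.ofLp ⬝ᵥ (polyMatAt Φ x *ᵥ (w x).ofLp)) := by
  rw [weightedField, EuclideanSpace.inner_eq_star_dotProduct, star_trivial, smul_dotProduct,
    smul_eq_mul, dotProduct_comm]

theorem MemL2Matrix.integrableOn_inner {Ω : Set Plane} {ρ : Plane → ℝ}
    {Φ : Matrix (Fin 2) (Fin 2) Poly2} (hopen : IsOpen Ω)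
    (hρ : IsMomentWeight Ω ρ) (hpos : ∀ x ∈ Ω, 0 < ρ x) (hc : ContinuousOn ρ Ω)
    (hpd : ∀ x ∈ Ω, (polyMatAt Φ x).PosDef) {h : Plane → Plane} (hh : MemL2Matrix Ω ρ Φ h)
    (v : Fin 2 → Poly2) :
    IntegrableOn (fun x => inner ℝ (h x) (weightedField ρ Φ (polyField v) x)) Ω := by
  have hvv : ∀ x, inner ℝ (polyField v x) (weightedField ρ Φ (polyField v) x) =
      polyAt (∑ i, ∑ k, v i * Φ i k * v k) x * ρ x := by
    intro x
    rw [inner_weightedField, quadratic_form_eq, polyAt_sum, mul_comm]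
    congr 1
    refine Finset.sum_congr rfl fun i _ => ?_
    rw [polyAt_sum, Finset.mul_sum]
    exact Finset.sum_congr rfl fun k _ => by simp only [polyAt_mul, polyField]; ring
  refine Integrable.mono' (hh.2.add (hρ.integrableOn_poly (∑ i, ∑ k, v i * Φ i k * v k))) ?_ ?_
  · refine hh.1.inner (ContinuousOn.aestronglyMeasurable ?_ hopen.measurableSet)
    have : weightedField ρ Φ (polyField v) = fun x => WithLp.toLp 2 fun i =>
        ρ x * polyAt (∑ k, Φ i k * v k) x := by
      ext x i
      rw [weightedField_polyField_apply]
    rw [this]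
    refine (PiLp.continuous_toLp 2 _).comp_continuousOn (continuousOn_pi.2 fun i => ?_)
    exact hc.mul (continuous_polyAt _).continuousOn
  · refine (ae_restrict_iff' hopen.measurableSet).2 (Eventually.of_forall fun x hx => ?_)
    rw [Real.norm_eq_abs, Pi.add_apply, ← hvv, inner_weightedField, inner_weightedField,
      inner_weightedField, abs_mul, abs_of_pos (hpos x hx), ← mul_add]
    exact mul_le_mul_of_nonneg_left ((hpd x hx).posSemidef.abs_dotProduct_mulVec_le _ _)
      (hpos x hx).le

/-! ### Derivative of the cutoff and the product rule -/

theorem hasFDerivAt_cutoff {θ : ℝ → ℝ} (hθ : Differentiable ℝ θ) (a s : Poly2) (N : ℝ)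
    (x : Plane) :
    HasFDerivAt (fun y => θ (N * polyAt a y) * (1 - θ (polyAt s y / N)))
      (θ (N * polyAt a x) • -((deriv θ (polyAt s x / N) * N⁻¹) • fderiv ℝ (polyAt s) x) +
        ((1 - θ (polyAt s x / N)) * (deriv θ (N * polyAt a x) * N)) • fderiv ℝ (polyAt a) x) x := by
  have ha := (differentiable_polyAt a x).hasFDerivAt.const_mul N
  have hs := (differentiable_polyAt s x).hasFDerivAt.const_mul N⁻¹
  have h1 := (hθ (N * polyAt a x)).hasDerivAt.comp_hasFDerivAt x ha
  have h2 := ((hθ (N⁻¹ * polyAt s x)).hasDerivAt.comp_hasFDerivAt x hs).const_sub 1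
  have h := h1.fun_mul h2
  simp only [smul_smul, Function.comp_def, inv_mul_eq_div] at h
  exact h

/-- Because `P·∇a = a M`, the large factor `N` enters only through `N a θ'(N a)`, which is bounded
independently of `N`. -/
theorem sum_mul_fderiv_cutoff {θ : ℝ → ℝ} (hθ : Differentiable ℝ θ) {a s M : Poly2}
    {P : Fin 2 → Poly2} (hM : ∑ i, P i * MvPolynomial.pderiv i a = a * M) (N : ℝ) (x : Plane) :
    ∑ i, polyAt (P i) x * fderiv ℝ (fun y => θ (N * polyAt a y) * (1 - θ (polyAt s y / N))) x
        (EuclideanSpace.single i 1) =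
      (N * polyAt a x * deriv θ (N * polyAt a x)) * (1 - θ (polyAt s x / N)) * polyAt M x -
        θ (N * polyAt a x) * (deriv θ (polyAt s x / N) * N⁻¹) *
          polyAt (∑ i, P i * MvPolynomial.pderiv i s) x := by
  have hM' := congrArg (fun p => polyAt p x) hM
  simp only [Fin.sum_univ_two, polyAt_add, polyAt_mul] at hM'
  rw [(hasFDerivAt_cutoff hθ a s N x).fderiv]
  simp only [Fin.sum_univ_two, _root_.add_apply, _root_.smul_apply, _root_.neg_apply,
    fderiv_polyAt_single, smul_eq_mul, polyAt_add, polyAt_mul]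
  linear_combination (N * deriv θ (N * polyAt a x)) * (1 - θ (polyAt s x / N)) * hM'

theorem abs_sum_mul_fderiv_cutoff_le {θ : ℝ → ℝ} {C : ℝ} (hθ : Differentiable ℝ θ)
    (hθ0 : ∀ t, 0 ≤ θ t) (hθ1 : ∀ t, θ t ≤ 1) (hC : ∀ t, |deriv θ t| ≤ C)
    (hC' : ∀ t, |t * deriv θ t| ≤ C) {a s M : Poly2} {P : Fin 2 → Poly2}
    (hM : ∑ i, P i * MvPolynomial.pderiv i a = a * M) {N : ℝ} (hN : 1 ≤ N) (x : Plane) :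
    |∑ i, polyAt (P i) x * fderiv ℝ (fun y => θ (N * polyAt a y) * (1 - θ (polyAt s y / N))) x
        (EuclideanSpace.single i 1)| ≤
      C * |polyAt M x| + C * |polyAt (∑ i, P i * MvPolynomial.pderiv i s) x| := by
  have hC0 : 0 ≤ C := (abs_nonneg _).trans (hC 0)
  have hNinv : N⁻¹ ≤ 1 := inv_le_one_of_one_le₀ hN
  have hNinv0 : 0 ≤ N⁻¹ := by positivity
  rw [sum_mul_fderiv_cutoff hθ hM]
  refine (abs_sub _ _).trans (add_le_add ?_ ?_)
  · rw [abs_mul, abs_mul]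
    refine mul_le_mul_of_nonneg_right ?_ (abs_nonneg _)
    have : |1 - θ (polyAt s x / N)| ≤ 1 :=
      abs_le.2 ⟨by linarith [hθ1 (polyAt s x / N)], by linarith [hθ0 (polyAt s x / N)]⟩
    simpa using mul_le_mul (hC' (N * polyAt a x)) this (abs_nonneg _) hC0
  · rw [abs_mul, abs_mul, abs_mul]
    refine mul_le_mul_of_nonneg_right ?_ (abs_nonneg _)
    have h1 : |θ (N * polyAt a x)| ≤ 1 :=
      abs_le.2 ⟨by linarith [hθ0 (N * polyAt a x)], hθ1 _⟩
    have h2 : |deriv θ (polyAt s x / N)| * |N⁻¹| ≤ C := by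
      rw [abs_of_nonneg hNinv0]
      simpa using mul_le_mul (hC (polyAt s x / N)) hNinv hNinv0 hC0
    simpa using mul_le_mul h1 h2 (by positivity) zero_le_one

theorem divergence_weightedField_eq {Ω : Set Plane} {ρ : Plane → ℝ}
    {Φ : Matrix (Fin 2) (Fin 2) Poly2} {b : Fin 2 → Poly2}
    (hd : ∀ x ∈ Ω, DifferentiableAt ℝ ρ x)
    (hb : ∀ x ∈ Ω, ∀ i, ∑ k, fderiv ℝ ρ x (EuclideanSpace.single k 1) * polyAt (Φ k i) x =
      ρ x * polyAt (b i) x) (v : Fin 2 → Poly2) {x : Plane} (hx : x ∈ Ω) :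
    divergence (weightedField ρ Φ (polyField v)) x =
      ρ x * polyAt (∑ i, (b i * v i + MvPolynomial.pderiv i (∑ k, Φ i k * v k))) x := by
  simp only [divergence, weightedField_polyField_apply]
  have hi : ∀ i, fderiv ℝ (fun y => ρ y * polyAt (∑ k, Φ i k * v k) y) x
      (EuclideanSpace.single i 1) =
      ρ x * polyAt (MvPolynomial.pderiv i (∑ k, Φ i k * v k)) x +
        polyAt (∑ k, Φ i k * v k) x * fderiv ℝ ρ x (EuclideanSpace.single i 1) := by
    intro i
    rw [((hd x hx).hasFDerivAt.fun_mul (differentiable_polyAt _ x).hasFDerivAt).fderiv]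
    simp only [_root_.add_apply, _root_.smul_apply, fderiv_polyAt_single, smul_eq_mul]
  have h0 := hb x hx 0
  have h1 := hb x hx 1
  have hP : ∀ i, polyAt (∑ k, Φ i k * v k) x =
      polyAt (Φ i 0) x * polyAt (v 0) x + polyAt (Φ i 1) x * polyAt (v 1) x := by
    intro i
    rw [Fin.sum_univ_two, polyAt_add, polyAt_mul, polyAt_mul]
  rw [Fin.sum_univ_two] at h0 h1
  rw [Fin.sum_univ_two (M := ℝ), hi, hi, hP, hP, polyAt_sum, Fin.sum_univ_two (M := ℝ), polyAt_add,
    polyAt_add, polyAt_mul, polyAt_mul]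
  linear_combination polyAt (v 0) x * h0 + polyAt (v 1) x * h1

theorem sum_fderiv_mul_weightedField {ρ u w : Plane → ℝ} {Φ : Matrix (Fin 2) (Fin 2) Poly2}
    (v : Fin 2 → Poly2) {x : Plane} (hρ : DifferentiableAt ℝ ρ x) (hu : DifferentiableAt ℝ u x)
    (hw : DifferentiableAt ℝ w x) :
    ∑ i, fderiv ℝ (fun y => w y * (u y * (ρ y * polyAt (∑ k, Φ i k * v k) y))) x
        (EuclideanSpace.single i 1) =
      w x * (u x * divergence (weightedField ρ Φ (polyField v)) x +
        inner ℝ (gradient u x) (weightedField ρ Φ (polyField v) x)) +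
      u x * ρ x * ∑ i, polyAt (∑ k, Φ i k * v k) x *
        fderiv ℝ w x (EuclideanSpace.single i 1) := by
  have hi : ∀ i, fderiv ℝ (fun y => w y * (u y * (ρ y * polyAt (∑ k, Φ i k * v k) y))) x
      (EuclideanSpace.single i 1) =
      w x * (u x * fderiv ℝ (fun y => ρ y * polyAt (∑ k, Φ i k * v k) y) x
        (EuclideanSpace.single i 1) +
        (ρ x * polyAt (∑ k, Φ i k * v k) x) * fderiv ℝ u x (EuclideanSpace.single i 1)) +
      (u x * (ρ x * polyAt (∑ k, Φ i k * v k) x)) * fderiv ℝ w x (EuclideanSpace.single i 1) := by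
    intro i
    have hF := (hρ.fun_mul (differentiable_polyAt (∑ k, Φ i k * v k) x)).hasFDerivAt
    rw [(hw.hasFDerivAt.fun_mul (hu.hasFDerivAt.fun_mul hF)).fderiv]
    simp only [_root_.add_apply, _root_.smul_apply, smul_eq_mul]
  rw [inner_gradient_apply, clm_apply_eq_sum]
  simp only [divergence, weightedField_polyField_apply]
  rw [Finset.sum_congr rfl fun i _ => hi i]
  simp only [Fin.sum_univ_two (M := ℝ)]
  ring

/-! ### Integration by parts -/

theorem proposition2p1 (Ω : Set Plane) (hopen : IsOpen Ω) (hsc : SimplyConnectedSpace Ω)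
    (hbd : HasPiecewiseC1Boundary Ω)
    (ρ : Plane → ℝ) (hρ : IsMomentWeight Ω ρ)
    (Φ : Matrix (Fin 2) (Fin 2) Poly2) (hsymm : Φ.IsSymm)
    (hdeg : ∀ i k, (Φ i k).totalDegree ≤ 2)
    (hpd : ∀ x ∈ Ω, (polyMatAt Φ x).PosDef)
    (hpearson : PearsonEquation Ω ρ Φ) (hneumann : NeumannCondition Ω ρ Φ)
    (u : Plane → ℝ) (hu : ContDiffOn ℝ 1 u (closure Ω))
    (huL2 : MemL2Weight Ω ρ u) (hgrad : MemL2Matrix Ω ρ Φ (gradient u))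
    (v : Fin 2 → Poly2) :
    IntegrableOn (fun x => u x * divergence (weightedField ρ Φ (polyField v)) x) Ω ∧
    IntegrableOn (fun x => inner ℝ (gradient u x) (weightedField ρ Φ (polyField v) x)) Ω ∧
    ∫ x in Ω, u x * divergence (weightedField ρ Φ (polyField v)) x =
      -∫ x in Ω, inner ℝ (gradient u x) (weightedField ρ Φ (polyField v) x) := by
  have hne : Ω.Nonempty := Set.nonempty_coe_sort.1 (inferInstance : Nonempty Ω)
  obtain ⟨b, hb⟩ := hpearson.exists_poly hopen
  obtain ⟨A, hA, hρA⟩ := exists_fderiv_eq_smul hpd hb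
  have hd : ∀ x ∈ Ω, DifferentiableAt ℝ ρ x := fun x hx =>
    (hpearson.1 x hx).differentiableAt (hopen.mem_nhds hx)
  have hpos := pos_of_fderiv_eq_smul hopen hpearson.1 hρ.pos hA hρA
  have hρ1 := contDiffOn_of_fderiv_eq_smul hopen hpearson.1 hA hρA
  have hu1 : ContDiffOn ℝ 1 u Ω := hu.mono subset_closure
  have hud : ∀ x ∈ Ω, DifferentiableAt ℝ u x := fun x hx =>
    (hu1.differentiableOn (by simp) x hx).differentiableAt (hopen.mem_nhds hx)
  obtain ⟨f, hffr, hfΩ, hfdvd⟩ :=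
    exists_boundary_polynomial hopen hne hbd hsymm hpd hd hpos hb hneumann
  choose L hL using hfdvd
  set P : Fin 2 → Poly2 := fun i => ∑ k, Φ i k * v k with hP
  -- By symmetry of `Φ`, `Φv·∇(f²) = 2f v·Φ∇f = 2f² v·L`. The square makes the cutoff variable
  -- positive on `Ω` whatever the sign of `f`.
  set M : Poly2 := 2 * ∑ k, v k * L k with hMdef
  have hM : ∑ i, P i * MvPolynomial.pderiv i (f ^ 2) = f ^ 2 * M := by
    have h0 := hL 0
    have h1 := hL 1
    have h01 := hsymm.apply 0 1
    simp only [hP, hMdef, Fin.sum_univ_two, Derivation.leibniz_pow, smul_eq_mul, nsmul_eq_mul]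
      at h0 h1 ⊢
    rw [h01] at h1
    rw [h01]
    push_cast
    linear_combination (2 * f * v 0) * h0 + (2 * f * v 1) * h1
  set s : Poly2 := MvPolynomial.X 0 ^ 2 + MvPolynomial.X 1 ^ 2 with hs
  have hsx : ∀ x, polyAt s x = ‖x‖ ^ 2 := by
    intro x
    rw [EuclideanSpace.norm_sq_eq, Fin.sum_univ_two, hs, polyAt_add, polyAt_pow, polyAt_pow,
      polyAt_X, polyAt_X]
    simp
  set Q : Poly2 := ∑ i, P i * MvPolynomial.pderiv i s with hQ
  obtain ⟨θ, C, hθ, hθ0, hθ1, hθz, hθo, hC, hC'⟩ := exists_smooth_step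
  have hθd := hθ.differentiable (by simp)
  have hint : ∀ p : Poly2, IntegrableOn (fun x => u x * (ρ x * polyAt p x)) Ω :=
    huL2.integrableOn_mul_poly hopen hρ hpos hρ1.continuousOn
  have hI1 : IntegrableOn (fun x => u x * divergence (weightedField ρ Φ (polyField v)) x) Ω :=
    (hint (∑ i, (b i * v i + MvPolynomial.pderiv i (P i)))).congr_fun (fun x hx => by
      simp only [divergence_weightedField_eq hd hb v hx, hP]) hopen.measurableSet
  have hI2 := hgrad.integrableOn_inner hopen hρ hpos hρ1.continuousOn hpd v
  refine ⟨hI1, hI2, ?_⟩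
  -- The shift to `N + 1` keeps the scale at least `1`, as the uniform bound requires.
  let w : ℕ → Plane → ℝ := fun N y =>
    θ ((N + 1 : ℝ) * polyAt (f ^ 2) y) * (1 - θ (polyAt s y / (N + 1 : ℝ)))
  have hw0 : ∀ N x, 0 ≤ w N x := fun N x =>
    mul_nonneg (hθ0 _) (by linarith [hθ1 (polyAt s x / (N + 1 : ℝ))])
  have hw1 : ∀ N x, w N x ≤ 1 := fun N x =>
    mul_le_one₀ (hθ1 _) (by linarith [hθ1 (polyAt s x / (N + 1 : ℝ))])
      (by linarith [hθ0 (polyAt s x / (N + 1 : ℝ))])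
  have hwc : ∀ N, ContDiff ℝ 1 (w N) := fun N =>
    (hθ.comp (contDiff_const.mul (contDiff_polyAt _))).mul
      (contDiff_const.sub (hθ.comp ((contDiff_polyAt _).div_const _)))
  let J : ℕ → Plane → ℝ := fun N x =>
    ∑ i, fderiv ℝ (fun y => w N y * (u y * (ρ y * polyAt (P i) y))) x (EuclideanSpace.single i 1)
  have hJ : ∀ N, ∀ x ∈ Ω, J N x =
      w N x * (u x * divergence (weightedField ρ Φ (polyField v)) x +
        inner ℝ (gradient u x) (weightedField ρ Φ (polyField v) x)) +
      u x * ρ x * ∑ i, polyAt (P i) x * fderiv ℝ (w N) x (EuclideanSpace.single i 1) :=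
    fun N x hx => sum_fderiv_mul_weightedField v (hd x hx) (hud x hx)
      ((hwc N).differentiable (by simp) x)
  have hV : ∀ N i, IntegrableOn (fun x => fderiv ℝ (fun y => w N y * (u y *
      (ρ y * polyAt (P i) y))) x (EuclideanSpace.single i 1)) Ω ∧
      ∫ x in Ω, fderiv ℝ (fun y => w N y * (u y * (ρ y * polyAt (P i) y))) x
        (EuclideanSpace.single i 1) = 0 := by
    intro N i
    have hN : (0 : ℝ) < N + 1 := by positivity
    -- Beyond radius `2(N+1)` one has `|x|²/(N+1) ≥ 2`, so the outer factor vanishes; near the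
    -- frontier `(N+1) f² < 1` kills the inner one.
    refine integrableOn_fderiv_and_integral_eq_zero (R := 2 * (N + 1)) hopen ?_ ?_ ?_ _
    · exact (hwc N).contDiffOn.mul (hu1.mul (hρ1.mul (contDiff_polyAt _).contDiffOn))
    · intro x hx
      have hc : ContinuousAt (fun y => (N + 1 : ℝ) * polyAt (f ^ 2) y) x :=
        (continuous_const.mul (continuous_polyAt _)).continuousAt
      have hx0 : (N + 1 : ℝ) * polyAt (f ^ 2) x < 1 := by
        rw [polyAt_pow, hffr x hx]; norm_num
      filter_upwards [hc.eventually_lt continuousAt_const hx0] with y hy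
      simp only [w]
      rw [hθz _ hy.le, zero_mul, zero_mul]
    · intro x hx
      have h2 : 2 ≤ polyAt s x / (N + 1 : ℝ) := by
        rw [le_div_iff₀ hN, hsx]
        have hN1 : (1 : ℝ) ≤ N + 1 := by linarith [(Nat.cast_nonneg N : (0 : ℝ) ≤ N)]
        nlinarith
      simp only [w]
      rw [hθo _ h2, sub_self, mul_zero, zero_mul]
  have hJint : ∀ N, ∫ x in Ω, J N x = 0 := fun N => by
    simp only [J]
    rw [integral_finsetSum _ fun i _ => (hV N i).1]
    exact Finset.sum_eq_zero fun i _ => (hV N i).2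
  have hJmeas : ∀ N, AEStronglyMeasurable (J N) (volume.restrict Ω) := fun N =>
    (integrable_finsetSum _ fun i _ => (hV N i).1).aestronglyMeasurable
  have hlim : Tendsto (fun N => ∫ x in Ω, J N x) atTop
      (𝓝 (∫ x in Ω, (u x * divergence (weightedField ρ Φ (polyField v)) x +
        inner ℝ (gradient u x) (weightedField ρ Φ (polyField v) x)))) := by
    refine tendsto_integral_of_dominated_convergence
      (fun x => (|u x * divergence (weightedField ρ Φ (polyField v)) x| +
        |inner ℝ (gradient u x) (weightedField ρ Φ (polyField v) x)|) +
        (C * |u x * (ρ x * polyAt M x)| + C * |u x * (ρ x * polyAt Q x)|)) hJmeas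
      ((hI1.abs.add hI2.abs).add (((hint M).abs.const_mul C).add ((hint Q).abs.const_mul C)))
      (fun N => ?_) ?_
    · refine (ae_restrict_iff' hopen.measurableSet).2 (Eventually.of_forall fun x hx => ?_)
      rw [hJ N x hx, Real.norm_eq_abs]
      refine (abs_add_le _ _).trans (add_le_add ?_ ?_)
      · rw [abs_mul, abs_of_nonneg (hw0 N x)]
        refine (mul_le_of_le_one_left (abs_nonneg _) (hw1 N x)).trans (abs_add_le _ _)
      · have hb := abs_sum_mul_fderiv_cutoff_le (s := s) hθd hθ0 hθ1 hC hC' hM (N := N + 1)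
          (by linarith [(Nat.cast_nonneg N : (0 : ℝ) ≤ N)]) x
        rw [abs_mul]
        refine (mul_le_mul_of_nonneg_left hb (abs_nonneg _)).trans (le_of_eq ?_)
        rw [← mul_assoc (u x), abs_mul (u x * ρ x), ← mul_assoc (u x), abs_mul (u x * ρ x)]
        ring
    -- At a fixed `x` in `Ω`, `(N+1) f² > 2` and `|x|² < N+1` eventually, so `w = 1` and both
    -- derivatives of `θ` are zero.
    · refine (ae_restrict_iff' hopen.measurableSet).2 (Eventually.of_forall fun x hx => ?_)
      refine tendsto_const_nhds.congr' ?_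
      have ha : 0 < polyAt (f ^ 2) x := by
        have := hfΩ x hx; rw [polyAt_pow]; positivity
      have hcast : Tendsto (fun N : ℕ => (N + 1 : ℝ)) atTop atTop :=
        tendsto_natCast_atTop_atTop.atTop_add tendsto_const_nhds
      filter_upwards [(hcast.atTop_mul_const ha).eventually_gt_atTop 2,
        hcast.eventually_gt_atTop (polyAt s x)] with N h2 h1
      have hN : (0 : ℝ) < N + 1 := by positivity
      have h1' : polyAt s x / (N + 1 : ℝ) < 1 := by rwa [div_lt_one hN]
      have hd2 : deriv θ ((N + 1 : ℝ) * polyAt (f ^ 2) x) = 0 := by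
        have : θ =ᶠ[𝓝 ((N + 1 : ℝ) * polyAt (f ^ 2) x)] fun _ => 1 := by
          filter_upwards [Ioi_mem_nhds h2] with t ht using hθo t (le_of_lt ht)
        rw [this.deriv_eq, deriv_const]
      have hd1 : deriv θ (polyAt s x / (N + 1 : ℝ)) = 0 := by
        have : θ =ᶠ[𝓝 (polyAt s x / (N + 1 : ℝ))] fun _ => 0 := by
          filter_upwards [Iio_mem_nhds h1'] with t ht using hθz t (le_of_lt ht)
        rw [this.deriv_eq, deriv_const]
      have hwN : w N x = 1 := by
        simp only [w]
        rw [hθo _ h2.le, hθz _ h1'.le]; norm_num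
      rw [hJ N x hx, hwN, sum_mul_fderiv_cutoff hθd hM, hd1, hd2]
      ring
  simp only [hJint] at hlim
  have h0 := tendsto_nhds_unique hlim tendsto_const_nhds
  rw [integral_add hI1 hI2] at h0
  linarith
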